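/- Let $G$ be a topological groupoid with non-empty unit space $G^{(0)}$, range and source maps $r,s$, and locally compact Hausdorff topology in which all structure maps are continuous. Assume that $G$ is ample, i.e. étale ($r$ is a local homeomorphism as a map $G\to G$) with totally disconnected unit space, that $G^{(0)}$ is compact, and that $G$ is almost finite: for every compact set $C\subseteq G$ and every $\varepsilon>0$ there is a compact open principal subgroupoid $K\subseteq G$ with $K^{(0)}=G^{(0)}$ such that $$\frac{|CKx\setminus Kx|}{|Kx|}<\varepsilon\qquad\text{for all }x\in G^{(0)},$$ where $Kx=\{k\in K: s(k)=x\}$ and $CKx=\{ck: c\in C,\ k\in K,\ s(c)=r(k),\ s(k)=x\}$. Let $C_r^*(G)$ be the reduced groupoid $C^*$-algebra, i.e. the completion of the convolution algebra $C_c(G)$ in the norm of the left regular representation on $\ell^2(G)=\bigoplus_{x\in G^{(0)}}\ell^2(Gx)$, and let $E\colon C_r^*(G)\to C(G^{(0)})$ be the canonical conditional expectation, which extends the restriction map $C_c(G)\to C(G^{(0)})$, $f\mapsto f|_{G^{(0)}}$. Let $T(C_r^*(G))$ be the set of tracial states of $C_r^*(G)$ with the weak$^*$ topology. Let $M(G)$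 be the set of regular Borel probability measures $\mu$ on $G^{(0)}$ with $\mu(s(V))=\mu(r(V))$ for every open bisection $V\subseteq G$ (an open set on which $r$ and $s$ restrict to homeomorphisms onto their images), also with the weak$^*$ topology. Then: 1. every $\tau\in T(C_r^*(G))$ satisfies $\tau=\tau|_{C(G^{(0)})}\circ E$; 2. the canonical map $T(C_r^*(G))\to M(G)$, which sends $\tau$ to the unique $\mu_\tau\in M(G)$ with $\tau(\varphi)=\int_{G^{(0)}}\varphi\,d\mu_\tau$ for all $\varphi\in C(G^{(0)})$, is well defined and is an affine homeomorphism; 3. this map restricts to a bijection between the sets of extreme points, $\partial_e T(C_r^*(G))=\partial_e M(G)$, and these sets are non-empty. -/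

import Mathlib

noncomputable section

open Set Filter Topology
open scoped CompactlySupported

/-- An algebraic groupoid with space of arrows `G` and space of objects `X`, with topologies
making all structure maps continuous. The object space `X` is identified with the unit space
`G⁽⁰⁾ ⊆ G` along `unit`, which is a homeomorphism onto its image because `rng ∘ unit = id`.
The product `mul a b` is meaningful only for composable pairs, i.e. when `src a = rng b`. -/
structure TopGroupoid (X G : Type*) [TopologicalSpace X] [TopologicalSpace G] where
  src : G → X
  rng : G → X
  unit : X → G
  inv : G → G
  mul : G → G → G
  src_unit : ∀ x, src (unit x) = x
  rng_unit : ∀ x, rng (unit x) = x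
  src_inv : ∀ a, src (inv a) = rng a
  rng_inv : ∀ a, rng (inv a) = src a
  src_mul : ∀ a b, src a = rng b → src (mul a b) = src b
  rng_mul : ∀ a b, src a = rng b → rng (mul a b) = rng a
  mul_assoc : ∀ a b c, src a = rng b → src b = rng c → mul (mul a b) c = mul a (mul b c)
  unit_mul : ∀ a, mul (unit (rng a)) a = a
  mul_unit : ∀ a, mul a (unit (src a)) = a
  inv_mul : ∀ a, mul (inv a) a = unit (src a)
  mul_inv : ∀ a, mul a (inv a) = unit (rng a)
  continuous_src : Continuous src
  continuous_rng : Continuous rng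
  continuous_unit : Continuous unit
  continuous_inv : Continuous inv
  continuous_mul : ContinuousOn (fun p : G × G => mul p.1 p.2) {p | src p.1 = rng p.2}

/-- A topological groupoid is étale if the range map, regarded as a map `G → G`, is a local
homeomorphism. -/
structure EtaleGroupoid (X G : Type*) [TopologicalSpace X] [TopologicalSpace G]
    extends TopGroupoid X G where
  etale : IsLocalHomeomorph (fun a => unit (rng a))

namespace TopGroupoid

variable {X G : Type*} [TopologicalSpace X] [TopologicalSpace G] (𝒢 : TopGroupoid X G)

/-- A bisection: range and source restrict to homeomorphisms onto their images. -/
def IsBisection (V : Set G) : Prop :=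
  IsEmbedding (V.domRestrict 𝒢.src) ∧ IsEmbedding (V.domRestrict 𝒢.rng)

/-- A subgroupoid `K ⊆ G` with `K⁽⁰⁾ = G⁽⁰⁾`. -/
structure IsWideSubgroupoid (K : Set G) : Prop where
  unit_mem : ∀ x, 𝒢.unit x ∈ K
  inv_mem : ∀ a ∈ K, 𝒢.inv a ∈ K
  mul_mem : ∀ a ∈ K, ∀ b ∈ K, 𝒢.src a = 𝒢.rng b → 𝒢.mul a b ∈ K

/-- An elementary subgroupoid: compact, open, principal, and containing all units. -/
structure IsElementary (K : Set G) : Prop extends 𝒢.IsWideSubgroupoid K where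
  isCompact : IsCompact K
  isOpen : IsOpen K
  principal : ∀ a ∈ K, 𝒢.src a = 𝒢.rng a → a ∈ range 𝒢.unit

/-- The product `A B = {ab | a ∈ A, b ∈ B, s(a) = r(b)}` of two subsets of `G`. -/
def setMul (A B : Set G) : Set G :=
  {c | ∃ a ∈ A, ∃ b ∈ B, 𝒢.src a = 𝒢.rng b ∧ c = 𝒢.mul a b}

/-- The set `A x = {a ∈ A | s(a) = x}`. -/
def fiber (A : Set G) (x : X) : Set G := {a ∈ A | 𝒢.src a = x}

/-- `(C, ε)`-invariance of a compact subgroupoid `K` with `K⁽⁰⁾ = G⁽⁰⁾`: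
`|C K x \ K x| / |K x| < ε` for every unit `x`. For `C`, `K` compact and `G` étale Hausdorff,
both sets are finite, and `K x` contains the unit at `x`. -/
def IsInvariantFor (C : Set G) (ε : ℝ) (K : Set G) : Prop :=
  ∀ x : X, ((𝒢.fiber (𝒢.setMul C K) x \ 𝒢.fiber K x).ncard : ℝ) / ((𝒢.fiber K x).ncard : ℝ) < ε

/-- The approximation property in the definition of almost finiteness. -/
def HasElementaryApproximation : Prop :=
  ∀ C : Set G, IsCompact C → ∀ ε : ℝ, 0 < ε →
    ∃ K : Set G, 𝒢.IsElementary K ∧ 𝒢.IsInvariantFor C ε K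

lemma unit_injective : Function.Injective 𝒢.unit := fun x y h => by
  rw [← 𝒢.rng_unit x, h, 𝒢.rng_unit]

lemma inv_inv (a : G) : 𝒢.inv (𝒢.inv a) = a := by
  have h1 := 𝒢.mul_assoc (𝒢.inv (𝒢.inv a)) (𝒢.inv a) a
    (by simp [src_inv, rng_inv]) (by simp [src_inv])
  rw [𝒢.inv_mul, 𝒢.inv_mul, 𝒢.src_inv, 𝒢.unit_mul] at h1
  have h2 := 𝒢.mul_unit (𝒢.inv (𝒢.inv a))
  rw [𝒢.src_inv, 𝒢.rng_inv] at h2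
  exact (h1.trans h2).symm

lemma inv_mul_cancel_left (a b : G) (h : 𝒢.rng a = 𝒢.rng b) :
    𝒢.mul a (𝒢.mul (𝒢.inv a) b) = b := by
  rw [← 𝒢.mul_assoc _ _ _ (by rw [rng_inv]) (by rw [src_inv, h]), mul_inv, h, unit_mul]

lemma mul_inv_cancel_left (a b : G) (h : 𝒢.src a = 𝒢.rng b) :
    𝒢.mul (𝒢.inv a) (𝒢.mul a b) = b := by
  rw [← 𝒢.mul_assoc _ _ _ (by rw [src_inv]) h, inv_mul, h, unit_mul]

lemma mul_inv_cancel_right (a b : G) (h : 𝒢.src a = 𝒢.src b) :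
    𝒢.mul (𝒢.mul a (𝒢.inv b)) b = a := by
  rw [𝒢.mul_assoc _ _ _ (by rw [rng_inv, h]) (by rw [src_inv]), inv_mul, ← h, mul_unit]

lemma mul_mul_inv_cancel (a b : G) (h : 𝒢.src a = 𝒢.rng b) :
    𝒢.mul (𝒢.mul a b) (𝒢.inv b) = a := by
  rw [𝒢.mul_assoc _ _ _ h (by rw [rng_inv]), mul_inv, ← h, mul_unit]

lemma inv_unit (x : X) : 𝒢.inv (𝒢.unit x) = 𝒢.unit x := by
  have h := 𝒢.mul_unit (𝒢.inv (𝒢.unit x))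
  rw [src_inv, rng_unit, inv_mul, src_unit] at h
  exact h.symm

lemma inv_mul_rev (a b : G) (h : 𝒢.src a = 𝒢.rng b) :
    𝒢.inv (𝒢.mul a b) = 𝒢.mul (𝒢.inv b) (𝒢.inv a) := by
  have h2 : 𝒢.mul (𝒢.inv (𝒢.mul a b)) (𝒢.mul a b) = 𝒢.unit (𝒢.src b) := by
    rw [inv_mul, src_mul _ _ _ h]
  have h3 := congrArg (fun t => 𝒢.mul (𝒢.mul t (𝒢.inv b)) (𝒢.inv a)) h2
  have h4 : 𝒢.src (𝒢.inv (𝒢.mul a b)) = 𝒢.rng a := by rw [src_inv, rng_mul _ _ _ h]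
  rw [← 𝒢.mul_assoc _ a b (by rw [h4]) h, mul_mul_inv_cancel _ _ _ (by rw [src_mul, h]; rw [h4]),
    mul_mul_inv_cancel _ _ _ h4, ← 𝒢.rng_inv b, unit_mul] at h3
  exact h3

lemma mul_inv_self_iff (a b : G) (h : 𝒢.src a = 𝒢.src b) :
    𝒢.mul a (𝒢.inv b) ∈ range 𝒢.unit ↔ a = b := by
  constructor
  · rintro ⟨x, hx⟩
    have h1 := 𝒢.mul_inv_cancel_right a b h
    have h2 : 𝒢.src (𝒢.mul a (𝒢.inv b)) = 𝒢.rng b := by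
      rw [src_mul _ _ _ (by rw [rng_inv, h]), src_inv]
    rw [← hx, src_unit] at h2
    rw [← hx, h2, unit_mul] at h1
    exact h1.symm
  · rintro rfl
    exact ⟨_, (𝒢.mul_inv a).symm⟩

lemma t2Space_units {X G : Type*} [TopologicalSpace X] [TopologicalSpace G]
    (𝒢 : TopGroupoid X G) [T2Space G] : T2Space X :=
  .of_injective_continuous 𝒢.unit_injective 𝒢.continuous_unit

end TopGroupoid

namespace EtaleGroupoid

variable {X G : Type*} [TopologicalSpace X] [TopologicalSpace G] (𝒢 : EtaleGroupoid X G)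

/-- Ample: étale with totally disconnected unit space. -/
def IsAmple {X G : Type*} [TopologicalSpace X] [TopologicalSpace G]
    (_𝒢 : EtaleGroupoid X G) : Prop := TotallyDisconnectedSpace X

/-- Almost finite, for an ample groupoid (with compact unit space). -/
def IsAlmostFinite : Prop := 𝒢.IsAmple ∧ 𝒢.HasElementaryApproximation

lemma exists_local_section (a : G) (W : Set G) (hW : IsOpen W) (ha : a ∈ W) :
    ∃ (U : Set G) (V : Set X) (σ : X → G), IsOpen U ∧ a ∈ U ∧ U ⊆ W ∧ IsOpen V ∧
      ContinuousOn σ V ∧ (∀ x ∈ V, σ x ∈ U ∧ 𝒢.rng (σ x) = x) ∧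
      ∀ g ∈ U, 𝒢.rng g ∈ V ∧ σ (𝒢.rng g) = g := by
  obtain ⟨e, hae, he⟩ := 𝒢.etale a
  have hef : ∀ g, e g = 𝒢.unit (𝒢.rng g) := fun g => (congrFun he g).symm
  let e' := e.restrOpen W hW
  have hs : e'.source = e.source ∩ W := e.restrOpen_source W hW
  have hef' : ∀ g, e' g = 𝒢.unit (𝒢.rng g) := hef
  refine ⟨e'.source, 𝒢.unit ⁻¹' e'.target, fun x => e'.symm (𝒢.unit x), e'.open_source,
    (by rw [hs]; exact ⟨hae, ha⟩), hs ▸ inter_subset_right, e'.open_target.preimage 𝒢.continuous_unit,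
    e'.continuousOn_symm.comp 𝒢.continuous_unit.continuousOn (fun x hx => hx), ?_, ?_⟩
  · intro x hx
    refine ⟨e'.map_target hx, 𝒢.unit_injective ?_⟩
    rw [← hef', e'.right_inv hx]
  · intro g hg
    refine ⟨?_, ?_⟩
    · rw [mem_preimage, ← hef']; exact e'.map_source hg
    · simp only [← hef']; exact e'.left_inv hg

/-- Compact sets meet the range fibres in uniformly finitely many points. -/
lemma exists_rng_fiber_bound {K : Set G} (hK : IsCompact K) :
    ∃ N : ℕ, ∀ x, {a ∈ K | 𝒢.rng a = x}.encard ≤ N := by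
  refine hK.induction_on (p := fun K => ∃ N : ℕ, ∀ x, {a ∈ K | 𝒢.rng a = x}.encard ≤ N)
    ⟨0, by simp⟩ ?_ ?_ ?_
  · rintro s t hst ⟨N, hN⟩
    exact ⟨N, fun x => (encard_le_encard
      (show {a ∈ s | 𝒢.rng a = x} ⊆ {a ∈ t | 𝒢.rng a = x} from
        fun a ha => ⟨hst ha.1, ha.2⟩)).trans (hN x)⟩
  · rintro s t ⟨N, hN⟩ ⟨M, hM⟩
    refine ⟨N + M, fun x => ?_⟩
    have : {a ∈ s ∪ t | 𝒢.rng a = x} = {a ∈ s | 𝒢.rng a = x} ∪ {a ∈ t | 𝒢.rng a = x} := by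
      ext a; simp only [mem_ofPred_eq, mem_union]; tauto
    rw [this]
    refine (encard_union_le _ _).trans ?_
    push_cast
    exact add_le_add (hN x) (hM x)
  · intro a _
    obtain ⟨U, V, σ, hU, haU, -, -, -, -, h⟩ := 𝒢.exists_local_section a univ isOpen_univ trivial
    refine ⟨U, mem_nhdsWithin_of_mem_nhds (hU.mem_nhds haU), 1, fun x => ?_⟩
    rw [Nat.cast_one, encard_le_one_iff]
    rintro b c ⟨hb, rfl⟩ ⟨hc, hc'⟩
    rw [← (h b hb).2, ← (h c hc).2, hc']

lemma exists_src_fiber_bound {K : Set G} (hK : IsCompact K) :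
    ∃ N : ℕ, ∀ x, {a ∈ K | 𝒢.src a = x}.encard ≤ N := by
  obtain ⟨N, hN⟩ := 𝒢.exists_rng_fiber_bound (hK.image 𝒢.continuous_inv)
  refine ⟨N, fun x => le_trans ?_ (hN x)⟩
  have hinj : Function.Injective 𝒢.inv := fun a b h => by rw [← 𝒢.inv_inv a, h, 𝒢.inv_inv]
  rw [← hinj.encard_image]
  refine encard_le_encard ?_
  rintro _ ⟨a, ⟨ha, rfl⟩, rfl⟩
  exact ⟨⟨a, ha, rfl⟩, 𝒢.rng_inv a⟩

/-- Sums over range fibres of a continuous function supported in a compact set are continuous. -/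
lemma continuous_fiber_sum [T2Space G] {Z : Type*} [TopologicalSpace Z] {q : Z → X}
    (hq : Continuous q) {K : Set G} (hK : IsCompact K) (F : G → Z → ℂ)
    (hF : ∀ a z, 𝒢.rng a = q z → a ∉ K → F a z = 0)
    (hc : ContinuousOn (fun p : G × Z => F p.1 p.2) {p | 𝒢.rng p.1 = q p.2}) :
    Continuous fun z => ∑ᶠ (a : G) (_ : 𝒢.rng a = q z), F a z := by
  classical
  have := 𝒢.t2Space_units
  rw [continuous_iff_continuousAt]
  intro z₀
  obtain ⟨N, hN⟩ := 𝒢.exists_rng_fiber_bound hK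
  have hfin : {a ∈ K | 𝒢.rng a = q z₀}.Finite := finite_of_encard_le_coe (hN _)
  obtain ⟨D, hD, hDd⟩ := hfin.t2_separation
  choose U V σ hU haU hUD hV hσ hσ1 hσ2 using
    fun a : G => 𝒢.exists_local_section a (D a) (hD a).2 (hD a).1
  set S := hfin.toFinset with hS
  have hSm : ∀ a, a ∈ S ↔ a ∈ K ∧ 𝒢.rng a = q z₀ := fun a => by simp [hS]
  have hK' : IsCompact (K \ ⋃ a ∈ S, U a) :=
    hK.diff (isOpen_biUnion fun a _ => hU a)
  have hcl : IsClosed (𝒢.rng '' (K \ ⋃ a ∈ S, U a)) := (hK'.image 𝒢.continuous_rng).isClosed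
  set W : Set Z := q ⁻¹' (𝒢.rng '' (K \ ⋃ a ∈ S, U a))ᶜ ∩ ⋂ a ∈ S, q ⁻¹' V a with hW
  have hWo : IsOpen W := (hcl.isOpen_compl.preimage hq).inter
    (isOpen_biInter_finset fun a _ => (hV a).preimage hq)
  have hz₀ : z₀ ∈ W := by
    refine ⟨?_, ?_⟩
    · rintro ⟨a, ⟨haK, hn⟩, har⟩
      exact hn (mem_biUnion ((hSm a).2 ⟨haK, har⟩) (haU a))
    · rw [mem_iInter₂]
      intro a ha
      rw [mem_preimage, ← ((hSm a).1 ha).2]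
      exact (hσ2 a a (haU a)).1
  have hWV : ∀ z ∈ W, ∀ a ∈ S, q z ∈ V a := fun z hz a ha => (mem_iInter₂.1 hz.2 a ha)
  have key : ∀ z ∈ W, (∑ᶠ (a : G) (_ : 𝒢.rng a = q z), F a z) = ∑ a ∈ S, F (σ a (q z)) z := by
    intro z hz
    have hinj : Set.InjOn (fun a => σ a (q z)) S := by
      intro a ha b hb hab
      by_contra hne
      have h1 := hDd (show a ∈ {a ∈ K | 𝒢.rng a = q z₀} from (hSm a).1 ha)
        (show b ∈ {a ∈ K | 𝒢.rng a = q z₀} from (hSm b).1 hb) hne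
      refine Set.disjoint_left.1 h1 (hUD a (hσ1 a _ (hWV z hz a ha)).1) ?_
      simp only at hab
      rw [hab]
      exact hUD b (hσ1 b _ (hWV z hz b hb)).1
    rw [← Finset.sum_image (f := fun b => F b z) hinj]
    refine finsum_mem_eq_sum_of_inter_support_eq (s := {a | 𝒢.rng a = q z}) _ ?_
    ext b
    simp only [mem_inter_iff, mem_ofPred_eq, Function.mem_support, Finset.coe_image, mem_image,
      Finset.mem_coe]
    constructor
    · rintro ⟨hb, hne⟩
      refine ⟨?_, hne⟩
      have hbK : b ∈ K := by
        by_contra h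
        exact hne (hF b z hb h)
      have : b ∈ ⋃ a ∈ S, U a := by
        by_contra h
        exact hz.1 ⟨b, ⟨hbK, h⟩, hb⟩
      obtain ⟨a, ha, hab⟩ := mem_iUnion₂.1 this
      exact ⟨a, ha, by rw [← hb]; exact (hσ2 a b hab).2⟩
    · rintro ⟨⟨a, ha, rfl⟩, hne⟩
      exact ⟨(hσ1 a _ (hWV z hz a ha)).2, hne⟩
  have hcont : ContinuousOn (fun z => ∑ a ∈ S, F (σ a (q z)) z) W := by
    refine continuousOn_finsetSum _ fun a ha => ?_
    refine hc.comp (f := fun z => (σ a (q z), z)) (ContinuousOn.prodMk ?_ continuousOn_id) ?_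
    · exact (hσ a).comp hq.continuousOn fun z hz => hWV z hz a ha
    · intro z hz
      exact (hσ1 a _ (hWV z hz a ha)).2
  exact ((hcont.congr key).continuousAt (hWo.mem_nhds hz₀))

end EtaleGroupoid

/-! Bounded operators on `ℓ²` given by kernels with uniformly finite rows and columns. -/

/-- The Hilbert space `ℓ²(ι)`. -/
abbrev EllTwo (ι : Type*) : Type _ := lp (fun _ : ι => ℂ) 2

/-- Kernels that are bounded and have uniformly finitely many non-zero entries in each row and
each column. -/
structure IsBandKernel {ι : Type*} (k : ι → ι → ℂ) (N : ℕ) (M : ℝ) : Prop where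
  row : ∀ a, {b | k a b ≠ 0}.encard ≤ N
  col : ∀ b, {a | k a b ≠ 0}.encard ≤ N
  bound : ∀ a b, ‖k a b‖ ≤ M

namespace IsBandKernel

variable {ι : Type*} {k : ι → ι → ℂ} {N : ℕ} {M : ℝ}

lemma row_finite (h : IsBandKernel k N M) (a : ι) : {b | k a b ≠ 0}.Finite :=
  finite_of_encard_le_coe (h.row a)

lemma col_finite (h : IsBandKernel k N M) (b : ι) : {a | k a b ≠ 0}.Finite :=
  finite_of_encard_le_coe (h.col b)

lemma support_finite (h : IsBandKernel k N M) (ξ : ι → ℂ) (a : ι) :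
    (Function.support fun b => k a b * ξ b).Finite :=
  (h.row_finite a).subset fun b hb => by
    simp only [Function.mem_support] at hb
    exact left_ne_zero_of_mul hb

lemma sum_le (h : IsBandKernel k N M) (ξ : EllTwo ι) (s : Finset ι) :
    ∑ a ∈ s, ‖∑ᶠ b, k a b * ξ b‖ ^ 2 ≤ (N * M * ‖ξ‖) ^ 2 := by
  classical
  set S : ι → Finset ι := fun a => (h.row_finite a).toFinset with hS
  set C : ι → Finset ι := fun b => (h.col_finite b).toFinset with hC
  have hSc : ∀ a, ((S a).card : ℝ) ≤ N := fun a => by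
    have := h.row a
    rw [(h.row_finite a).encard_eq_coe_toFinset_card] at this
    exact_mod_cast this
  have hCc : ∀ b, ((C b).card : ℝ) ≤ N := fun b => by
    have := h.col b
    rw [(h.col_finite b).encard_eq_coe_toFinset_card] at this
    exact_mod_cast this
  have h1 : ∀ a, ‖∑ᶠ b, k a b * ξ b‖ ^ 2 ≤ N * M ^ 2 * ∑ b ∈ S a, ‖ξ b‖ ^ 2 := by
    intro a
    have e : ∑ᶠ b, k a b * ξ b = ∑ b ∈ S a, k a b * ξ b :=
      finsum_eq_sum_of_support_subset _ fun b hb => by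
        simp only [Function.mem_support] at hb
        simpa [hS] using left_ne_zero_of_mul hb
    have e2 : ‖∑ᶠ b, k a b * ξ b‖ ≤ M * ∑ b ∈ S a, ‖ξ b‖ := by
      rw [e, Finset.mul_sum]
      refine (norm_sum_le _ _).trans (Finset.sum_le_sum fun b _ => ?_)
      rw [norm_mul]
      exact mul_le_mul_of_nonneg_right (h.bound a b) (norm_nonneg _)
    have e3 : (∑ b ∈ S a, ‖ξ b‖) ^ 2 ≤ N * ∑ b ∈ S a, ‖ξ b‖ ^ 2 :=
      (sq_sum_le_card_mul_sum_sq).trans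
        (mul_le_mul_of_nonneg_right (hSc a) (Finset.sum_nonneg fun _ _ => by positivity))
    calc ‖∑ᶠ b, k a b * ξ b‖ ^ 2 ≤ (M * ∑ b ∈ S a, ‖ξ b‖) ^ 2 := by gcongr
      _ = M ^ 2 * (∑ b ∈ S a, ‖ξ b‖) ^ 2 := by ring
      _ ≤ M ^ 2 * (N * ∑ b ∈ S a, ‖ξ b‖ ^ 2) := by gcongr
      _ = _ := by ring
  have h2 : ∑ a ∈ s, ∑ b ∈ S a, ‖ξ b‖ ^ 2 ≤ N * ‖ξ‖ ^ 2 := by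
    rw [Finset.sum_comm' (s' := fun b => s.filter (fun a => a ∈ C b)) (t' := s.biUnion S)]
    · have h3 : ∑ b ∈ s.biUnion S, ‖ξ b‖ ^ 2 ≤ ‖ξ‖ ^ 2 := by
        have := lp.sum_rpow_le_norm_rpow (p := 2) (by simp) ξ (s.biUnion S)
        simpa using this
      refine le_trans ?_ (mul_le_mul_of_nonneg_left h3 (Nat.cast_nonneg N))
      rw [Finset.mul_sum]
      refine Finset.sum_le_sum fun b _ => ?_
      rw [Finset.sum_const, nsmul_eq_mul]
      refine mul_le_mul_of_nonneg_right (le_trans ?_ (hCc b)) (by positivity)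
      exact_mod_cast Finset.card_le_card fun a ha => (Finset.mem_filter.1 ha).2
    · intro a b
      simp only [hS, hC, Finset.mem_filter, Finite.mem_toFinset, mem_ofPred_eq, Finset.mem_biUnion]
      constructor
      · rintro ⟨ha, hb⟩; exact ⟨⟨ha, hb⟩, a, ha, hb⟩
      · rintro ⟨hb, -⟩; exact hb
  calc ∑ a ∈ s, ‖∑ᶠ b, k a b * ξ b‖ ^ 2 ≤ ∑ a ∈ s, N * M ^ 2 * ∑ b ∈ S a, ‖ξ b‖ ^ 2 :=
        Finset.sum_le_sum fun a _ => h1 a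
    _ = N * M ^ 2 * ∑ a ∈ s, ∑ b ∈ S a, ‖ξ b‖ ^ 2 := by rw [Finset.mul_sum]
    _ ≤ N * M ^ 2 * (N * ‖ξ‖ ^ 2) := by gcongr
    _ = _ := by ring

lemma memℓp (h : IsBandKernel k N M) (ξ : EllTwo ι) :
    Memℓp (E := fun _ : ι => ℂ) (fun a => ∑ᶠ b, k a b * ξ b) 2 := by
  refine memℓp_gen' (C := (N * M * ‖ξ‖) ^ 2) fun s => ?_
  simpa using h.sum_le ξ s

/-- The bounded operator `(T ξ)(a) = ∑ b, k a b ξ(b)` on `ℓ²(ι)`. -/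
def op (h : IsBandKernel k N M) (hM : 0 ≤ M) : EllTwo ι →L[ℂ] EllTwo ι :=
  LinearMap.mkContinuous
    { toFun := fun ξ => ⟨fun a => ∑ᶠ b, k a b * ξ b, h.memℓp ξ⟩
      map_add' := fun ξ η => by
        ext a
        simp only [lp.coeFn_add, Pi.add_apply, mul_add]
        exact finsum_add_distrib (h.support_finite _ a) (h.support_finite _ a)
      map_smul' := fun c ξ => by
        ext a
        simp only [lp.coeFn_smul, Pi.smul_apply, smul_eq_mul, RingHom.id_apply]
        rw [mul_finsum]
        exact finsum_congr fun b => by ring }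
    (N * M) fun ξ => by
      refine lp.norm_le_of_forall_sum_le (by simp) (by positivity) fun s => ?_
      simpa using h.sum_le ξ s

lemma op_apply (h : IsBandKernel k N M) (hM : 0 ≤ M) (ξ : EllTwo ι) (a : ι) :
    h.op hM ξ a = ∑ᶠ b, k a b * ξ b := rfl

end IsBandKernel

open Classical in
lemma EllTwo.ext_op {ι : Type*} {S T : EllTwo ι →L[ℂ] EllTwo ι}
    (h : ∀ a c, S (lp.single 2 c (1 : ℂ)) a = T (lp.single 2 c (1 : ℂ)) a) : S = T := by
  refine lp.ext_continuousLinearMap (by simp) fun c => ?_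
  ext a
  simpa using h a c

namespace EtaleGroupoid

variable {X G : Type*} [TopologicalSpace X] [TopologicalSpace G] (𝒢 : EtaleGroupoid X G)

section Convolution

variable [T2Space G]

/-- Convolution on `C_c(G)`: `(f ⋆ g)(c) = ∑ f(a) g(a⁻¹ c)`, summed over `a` with `r(a) = r(c)`. -/
def conv (f g : C_c(G, ℂ)) : C_c(G, ℂ) where
  toFun c := ∑ᶠ (a : G) (_ : 𝒢.rng a = 𝒢.rng c), f a * g (𝒢.mul (𝒢.inv a) c)
  continuous_toFun := by
    refine 𝒢.continuous_fiber_sum 𝒢.continuous_rng (K := tsupport f) f.hasCompactSupport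
      (fun a c => f a * g (𝒢.mul (𝒢.inv a) c)) ?_ ?_
    · intro a c _ ha
      rw [image_eq_zero_of_notMem_tsupport ha, zero_mul]
    · refine (f.continuous.comp continuous_fst).continuousOn.mul
        (g.continuous.comp_continuousOn ?_)
      refine 𝒢.continuous_mul.comp (f := fun p : G × G => (𝒢.inv p.1, p.2))
        ((𝒢.continuous_inv.comp continuous_fst).prodMk continuous_snd).continuousOn ?_
      intro p hp
      simp only [mem_ofPred_eq] at hp ⊢
      rw [𝒢.src_inv, hp]
  hasCompactSupport' := by
    have := 𝒢.t2Space_units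
    set P : Set (G × G) := (tsupport f ×ˢ tsupport g) ∩ {p | 𝒢.src p.1 = 𝒢.rng p.2} with hP
    have hPc : IsCompact P :=
      (f.hasCompactSupport.isCompact.prod g.hasCompactSupport.isCompact).inter_right
        (isClosed_eq (𝒢.continuous_src.comp continuous_fst) (𝒢.continuous_rng.comp continuous_snd))
    refine HasCompactSupport.intro
      (hPc.image_of_continuousOn (𝒢.continuous_mul.mono inter_subset_right)) fun c hc => ?_
    refine finsum_mem_eq_zero_of_forall_eq_zero (s := {a | 𝒢.rng a = 𝒢.rng c}) fun a ha => ?_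
    simp only [mem_ofPred_eq] at ha
    by_contra hne
    refine hc ⟨(a, 𝒢.mul (𝒢.inv a) c), ⟨⟨?_, ?_⟩, ?_⟩, 𝒢.inv_mul_cancel_left a c ha⟩
    · exact subset_tsupport _ (left_ne_zero_of_mul hne)
    · exact subset_tsupport _ (right_ne_zero_of_mul hne)
    · simp only [mem_ofPred_eq]
      rw [𝒢.rng_mul _ _ (by rw [𝒢.src_inv, ha]), 𝒢.rng_inv]

/-- The involution on `C_c(G)`: `f*(a)` is the complex conjugate of `f(a⁻¹)`. -/
def involution (f : C_c(G, ℂ)) : C_c(G, ℂ) where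
  toFun a := starRingEnd ℂ (f (𝒢.inv a))
  continuous_toFun :=
    Complex.continuous_conj.comp (f.continuous.comp 𝒢.continuous_inv)
  hasCompactSupport' := by
    refine HasCompactSupport.intro
      (f.hasCompactSupport.isCompact.image 𝒢.continuous_inv) fun a ha => ?_
    rw [map_eq_zero]
    by_contra hne
    exact ha ⟨𝒢.inv a, subset_tsupport _ hne, 𝒢.inv_inv a⟩

lemma isClopen_units [CompactSpace X] : IsClopen (range 𝒢.unit) := by
  refine ⟨(isCompact_range 𝒢.continuous_unit).isClosed, ?_⟩
  have h : range 𝒢.unit = range (fun a => 𝒢.unit (𝒢.rng a)) := by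
    ext a
    constructor
    · rintro ⟨x, rfl⟩
      exact ⟨𝒢.unit x, by simp only [𝒢.rng_unit]⟩
    · rintro ⟨b, rfl⟩
      exact ⟨_, rfl⟩
  rw [h]
  exact 𝒢.etale.isOpenMap.isOpen_range

/-- The inclusion of `C(G⁽⁰⁾)` into `C_c(G)`, extending functions by zero. -/
def extendUnits [CompactSpace X] (φ : C(X, ℂ)) : C_c(G, ℂ) where
  toFun := (range 𝒢.unit).indicator (fun a => φ (𝒢.src a))
  continuous_toFun := (φ.continuous.comp 𝒢.continuous_src).indicator
    (by simp [𝒢.isClopen_units.frontier_eq])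
  hasCompactSupport' :=
    HasCompactSupport.intro (isCompact_range 𝒢.continuous_unit) fun _ ha =>
      indicator_of_notMem ha _

end Convolution

open Classical in
/-- The matrix entries `f(a b⁻¹)`, for `s(a) = s(b)`, of the left regular representation. -/
def kernel (f : C_c(G, ℂ)) (a b : G) : ℂ :=
  if 𝒢.src a = 𝒢.src b then f (𝒢.mul a (𝒢.inv b)) else 0

lemma exists_isBandKernel (f : C_c(G, ℂ)) :
    ∃ (N : ℕ) (M : ℝ), IsBandKernel (𝒢.kernel f) N M ∧ 0 ≤ M := by
  obtain ⟨N₁, h₁⟩ := 𝒢.exists_rng_fiber_bound f.hasCompactSupport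
  obtain ⟨N₂, h₂⟩ := 𝒢.exists_src_fiber_bound f.hasCompactSupport
  obtain ⟨M, hM⟩ := f.hasCompactSupport.exists_bound_of_continuous f.continuous
  have key : ∀ a b, 𝒢.kernel f a b ≠ 0 →
      𝒢.src a = 𝒢.src b ∧ 𝒢.mul a (𝒢.inv b) ∈ tsupport f := by
    intro a b h
    unfold kernel at h
    split_ifs at h with h'
    · exact ⟨h', subset_tsupport _ h⟩
    · exact absurd rfl h
  refine ⟨max N₁ N₂, max M 0, ⟨fun a => ?_, fun b => ?_, fun a b => ?_⟩, le_max_right _ _⟩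
  · have hinj : Set.InjOn (fun b => 𝒢.mul a (𝒢.inv b)) {b | 𝒢.kernel f a b ≠ 0} := by
      intro b hb c hc hbc
      have hb := (key a b hb).1
      have hc := (key a c hc).1
      change 𝒢.mul a (𝒢.inv b) = 𝒢.mul a (𝒢.inv c) at hbc
      have h3 := congrArg (fun t => 𝒢.inv (𝒢.mul (𝒢.inv a) t)) hbc
      rwa [𝒢.mul_inv_cancel_left _ _ (by rw [𝒢.rng_inv, hb]),
        𝒢.mul_inv_cancel_left _ _ (by rw [𝒢.rng_inv, hc]), 𝒢.inv_inv, 𝒢.inv_inv] at h3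
    rw [← hinj.encard_image]
    refine le_trans (encard_le_encard ?_) ((h₁ (𝒢.rng a)).trans (by exact_mod_cast le_max_left _ _))
    rintro _ ⟨b, hb, rfl⟩
    exact ⟨(key a b hb).2, 𝒢.rng_mul _ _ (by rw [𝒢.rng_inv, (key a b hb).1])⟩
  · have hinj : Set.InjOn (fun a => 𝒢.mul a (𝒢.inv b)) {a | 𝒢.kernel f a b ≠ 0} := by
      intro a ha c hc hac
      have ha := (key a b ha).1
      have hc := (key c b hc).1
      change 𝒢.mul a (𝒢.inv b) = 𝒢.mul c (𝒢.inv b) at hac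
      rw [← 𝒢.mul_inv_cancel_right a b ha, hac, 𝒢.mul_inv_cancel_right c b hc]
    rw [← hinj.encard_image]
    refine le_trans (encard_le_encard ?_)
      ((h₂ (𝒢.rng b)).trans (by exact_mod_cast le_max_right _ _))
    rintro _ ⟨a, ha, rfl⟩
    refine ⟨(key a b ha).2, ?_⟩
    rw [𝒢.src_mul _ _ (by rw [𝒢.rng_inv, (key a b ha).1]), 𝒢.src_inv]
  · unfold kernel
    split_ifs
    · exact (hM _).trans (le_max_left _ _)
    · simp

/-- The operator `(λ(f) ξ)(a) = ∑ f(a b⁻¹) ξ(b)`, summed over `b` with `s(b) = s(a)`, on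
`ℓ²(G) = ⨁ₓ ℓ²(G x)`. -/
def regularOp (f : C_c(G, ℂ)) : EllTwo G →L[ℂ] EllTwo G :=
  (𝒢.exists_isBandKernel f).choose_spec.choose_spec.1.op
    (𝒢.exists_isBandKernel f).choose_spec.choose_spec.2

lemma regularOp_apply (f : C_c(G, ℂ)) (ξ : EllTwo G) (a : G) :
    𝒢.regularOp f ξ a = ∑ᶠ b, 𝒢.kernel f a b * ξ b := rfl

open Classical in
lemma regularOp_single (f : C_c(G, ℂ)) (a c : G) :
    𝒢.regularOp f (lp.single 2 c (1 : ℂ)) a = 𝒢.kernel f a c := by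
  rw [regularOp_apply, finsum_eq_single _ c]
  · simp
  · intro b hb
    simp [hb]

/-- The left regular representation of `C_c(G)` on `ℓ²(G)`, as a linear map. -/
def regularRep : C_c(G, ℂ) →ₗ[ℂ] (EllTwo G →L[ℂ] EllTwo G) where
  toFun := 𝒢.regularOp
  map_add' f g := by
    classical
    refine EllTwo.ext_op fun a c => ?_
    simp only [add_apply, lp.coeFn_add, Pi.add_apply, regularOp_single, kernel]
    split_ifs <;> simp
  map_smul' z f := by
    classical
    refine EllTwo.ext_op fun a c => ?_
    simp only [smul_apply, lp.coeFn_smul, Pi.smul_apply, regularOp_single,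
      kernel, RingHom.id_apply]
    split_ifs <;> simp

lemma regularRep_apply (f : C_c(G, ℂ)) (ξ : EllTwo G) (a : G) :
    𝒢.regularRep f ξ a = ∑ᶠ b, 𝒢.kernel f a b * ξ b := rfl

open Classical in
lemma regularRep_single (f : C_c(G, ℂ)) (a c : G) :
    𝒢.regularRep f (lp.single 2 c (1 : ℂ)) a = 𝒢.kernel f a c := 𝒢.regularOp_single f a c

open Classical in
/-- The diagonal matrix coefficient `⟨δₓ, T δₓ⟩` at a unit `x`. -/
def diagCoeff (T : EllTwo G →L[ℂ] EllTwo G) (x : X) : ℂ :=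
  T (lp.single 2 (𝒢.unit x) (1 : ℂ)) (𝒢.unit x)

lemma diagCoeff_regularRep (f : C_c(G, ℂ)) (x : X) :
    𝒢.diagCoeff (𝒢.regularRep f) x = f (𝒢.unit x) := by
  classical
  have h : 𝒢.mul (𝒢.unit x) (𝒢.unit x) = 𝒢.unit x := by
    simpa only [𝒢.rng_unit] using 𝒢.unit_mul (𝒢.unit x)
  rw [diagCoeff, regularRep_single, kernel, if_pos rfl, 𝒢.inv_unit, h]

lemma norm_diagCoeff_le (T : EllTwo G →L[ℂ] EllTwo G) (x : X) : ‖𝒢.diagCoeff T x‖ ≤ ‖T‖ := by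
  classical
  refine (lp.norm_apply_le_norm (by simp) _ _).trans ((T.le_opNorm _).trans ?_)
  rw [lp.norm_single (by simp)]
  simp

variable [T2Space G]

lemma regularRep_conv (f g : C_c(G, ℂ)) :
    𝒢.regularRep (𝒢.conv f g) = 𝒢.regularRep f * 𝒢.regularRep g := by
  classical
  refine EllTwo.ext_op fun a c => ?_
  rw [mul_apply_eq_comp, regularRep_single, regularRep_apply]
  simp only [regularRep_single]
  by_cases hac : 𝒢.src a = 𝒢.src c
  · have e : 𝒢.kernel (𝒢.conv f g) a c = ∑ᶠ (b : G) (_ : 𝒢.rng b = 𝒢.rng a),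
        f b * g (𝒢.mul (𝒢.inv b) (𝒢.mul a (𝒢.inv c))) := by
      rw [kernel, if_pos hac]
      change (∑ᶠ (b : G) (_ : 𝒢.rng b = 𝒢.rng (𝒢.mul a (𝒢.inv c))), _) = _
      rw [𝒢.rng_mul _ _ (by rw [𝒢.rng_inv, hac])]
    have e2 : ∑ᶠ b, 𝒢.kernel f a b * 𝒢.kernel g b c = ∑ᶠ (b : G) (_ : 𝒢.src b = 𝒢.src a),
        f (𝒢.mul a (𝒢.inv b)) * g (𝒢.mul b (𝒢.inv c)) := by
      refine finsum_congr fun b => ?_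
      by_cases hb : 𝒢.src b = 𝒢.src a
      · rw [finsum_eq_if, if_pos hb, kernel, if_pos hb.symm, kernel, if_pos (hb.trans hac)]
      · rw [finsum_eq_if, if_neg hb, kernel, if_neg (Ne.symm hb), zero_mul]
    rw [e, e2]
    refine finsum_mem_eq_of_bijOn (s := {b | 𝒢.rng b = 𝒢.rng a}) (t := {b | 𝒢.src b = 𝒢.src a})
      (fun b => 𝒢.mul (𝒢.inv b) a) ⟨?_, ?_, ?_⟩ ?_
    · intro b hb
      simp only [mem_ofPred_eq] at hb ⊢
      rw [𝒢.src_mul _ _ (by rw [𝒢.src_inv, hb])]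
    · intro b hb d hd hbd
      simp only [mem_ofPred_eq] at hb hd
      change 𝒢.mul (𝒢.inv b) a = 𝒢.mul (𝒢.inv d) a at hbd
      have h3 := congrArg (fun t => 𝒢.inv (𝒢.mul t (𝒢.inv a))) hbd
      rwa [𝒢.mul_mul_inv_cancel _ _ (by rw [𝒢.src_inv, hb]),
        𝒢.mul_mul_inv_cancel _ _ (by rw [𝒢.src_inv, hd]), 𝒢.inv_inv, 𝒢.inv_inv] at h3
    · intro b hb
      simp only [mem_ofPred_eq] at hb
      refine ⟨𝒢.mul a (𝒢.inv b), ?_, ?_⟩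
      · simp only [mem_ofPred_eq]
        rw [𝒢.rng_mul _ _ (by rw [𝒢.rng_inv, hb])]
      · simp only
        rw [𝒢.inv_mul_rev _ _ (by rw [𝒢.rng_inv, hb]), 𝒢.inv_inv,
          𝒢.mul_inv_cancel_right _ _ (by rw [hb])]
    · intro b hb
      simp only [mem_ofPred_eq] at hb
      rw [𝒢.inv_mul_rev _ _ (by rw [𝒢.src_inv, hb]), 𝒢.inv_inv,
        𝒢.inv_mul_cancel_left _ _ hb.symm,
        𝒢.mul_assoc _ _ _ (by rw [𝒢.src_inv, hb]) (by rw [𝒢.rng_inv, hac])]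
  · rw [kernel, if_neg hac, finsum_eq_zero_of_forall_eq_zero]
    intro b
    by_cases hb : 𝒢.src a = 𝒢.src b
    · rw [kernel, kernel, if_neg (fun h => hac (hb.trans h)), mul_zero]
    · rw [kernel, if_neg hb, zero_mul]

lemma regularRep_involution (f : C_c(G, ℂ)) :
    𝒢.regularRep (𝒢.involution f) = star (𝒢.regularRep f) := by
  classical
  refine EllTwo.ext_op fun a c => ?_
  have h : star (𝒢.regularRep f) (lp.single 2 c (1 : ℂ)) a = starRingEnd ℂ (𝒢.kernel f c a) := by
    have h1 := lp.inner_single_left (𝕜 := ℂ) a (1 : ℂ)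
      (star (𝒢.regularRep f) (lp.single 2 c (1 : ℂ)))
    rw [ContinuousLinearMap.star_eq_adjoint, ContinuousLinearMap.adjoint_inner_right,
      lp.inner_single_right, regularRep_single] at h1
    simpa [ContinuousLinearMap.star_eq_adjoint] using h1.symm
  rw [h, regularRep_single, kernel, kernel]
  by_cases hac : 𝒢.src a = 𝒢.src c
  · rw [if_pos hac, if_pos hac.symm]
    change starRingEnd ℂ (f (𝒢.inv (𝒢.mul a (𝒢.inv c)))) = _
    rw [𝒢.inv_mul_rev _ _ (by rw [𝒢.rng_inv, hac]), 𝒢.inv_inv]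
  · rw [if_neg hac, if_neg (Ne.symm hac), map_zero]

variable [CompactSpace X]

lemma regularRep_one : 𝒢.regularRep (𝒢.extendUnits 1) = 1 := by
  classical
  refine EllTwo.ext_op fun a c => ?_
  rw [regularRep_single, one_apply_eq_self, kernel]
  by_cases hac : 𝒢.src a = 𝒢.src c
  · rw [if_pos hac]
    change (range 𝒢.unit).indicator (fun _ => (1 : ℂ)) _ = _
    by_cases h : a = c
    · rw [indicator_of_mem ((𝒢.mul_inv_self_iff a c hac).2 h), h]
      simp
    · rw [indicator_of_notMem (fun h' => h ((𝒢.mul_inv_self_iff a c hac).1 h'))]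
      simp [h]
  · rw [if_neg hac]
    have h : a ≠ c := fun h => hac (by rw [h])
    simp [h]

/-- The image of the convolution algebra `C_c(G)` under the left regular representation. -/
def regularAlgebra : StarSubalgebra ℂ (EllTwo G →L[ℂ] EllTwo G) where
  carrier := range 𝒢.regularRep
  mul_mem' := by
    rintro _ _ ⟨f, rfl⟩ ⟨g, rfl⟩
    exact ⟨𝒢.conv f g, 𝒢.regularRep_conv f g⟩
  add_mem' := by
    rintro _ _ ⟨f, rfl⟩ ⟨g, rfl⟩
    exact ⟨f + g, map_add _ _ _⟩
  algebraMap_mem' z :=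
    ⟨z • 𝒢.extendUnits 1, by rw [map_smul, regularRep_one, Algebra.algebraMap_eq_smul_one]⟩
  star_mem' := by
    rintro _ ⟨f, rfl⟩
    exact ⟨𝒢.involution f, 𝒢.regularRep_involution f⟩

/-- The reduced C⋆-algebra `C_r^*(G)`: the completion of the convolution algebra `C_c(G)` in the
norm of the left regular representation `⨁ₓ λₓ` on `ℓ²(G) = ⨁ₓ ℓ²(G x)`, realised as the norm
closure of its image. -/
def reducedAlgebra : StarSubalgebra ℂ (EllTwo G →L[ℂ] EllTwo G) :=
  𝒢.regularAlgebra.topologicalClosure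

/-- The canonical inclusion of `C_c(G)` into `C_r^*(G)`. -/
def ofCc (f : C_c(G, ℂ)) : 𝒢.reducedAlgebra :=
  ⟨𝒢.regularRep f, 𝒢.regularAlgebra.le_topologicalClosure ⟨f, rfl⟩⟩

/-- The canonical inclusion of `C(G⁽⁰⁾)` into `C_r^*(G)`. -/
def ofUnits (φ : C(X, ℂ)) : 𝒢.reducedAlgebra := 𝒢.ofCc (𝒢.extendUnits φ)

lemma continuous_diagCoeff {T : EllTwo G →L[ℂ] EllTwo G} (hT : T ∈ 𝒢.reducedAlgebra) :
    Continuous (𝒢.diagCoeff T) := by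
  refine continuous_of_uniform_approx_of_continuous fun u hu => ?_
  obtain ⟨ε, hε, hu⟩ := Metric.mem_uniformity_dist.1 hu
  obtain ⟨_, ⟨f, rfl⟩, hf⟩ := Metric.mem_closure_iff.1 hT ε hε
  refine ⟨fun x => f (𝒢.unit x), f.continuous.comp 𝒢.continuous_unit, fun x => hu ?_⟩
  simp only [← 𝒢.diagCoeff_regularRep f x]
  refine lt_of_le_of_lt ?_ hf
  rw [dist_eq_norm, dist_eq_norm]
  exact 𝒢.norm_diagCoeff_le (T - 𝒢.regularRep f) x

/-- The canonical conditional expectation `E : C_r^*(G) → C(G⁽⁰⁾)`, `E(a)(x) = ⟨δₓ, a δₓ⟩`,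
which extends the restriction map `C_c(G) → C(G⁽⁰⁾)`. -/
def expectation : 𝒢.reducedAlgebra →L[ℂ] C(X, ℂ) :=
  LinearMap.mkContinuous
    { toFun := fun a => ⟨𝒢.diagCoeff a, 𝒢.continuous_diagCoeff a.2⟩
      map_add' := fun _ _ => rfl
      map_smul' := fun _ _ => rfl } 1 fun a => by
      rw [one_mul]
      exact (ContinuousMap.norm_le _ (norm_nonneg _)).2 fun x => 𝒢.norm_diagCoeff_le a x

lemma expectation_ofCc (f : C_c(G, ℂ)) (x : X) :
    𝒢.expectation (𝒢.ofCc f) x = f (𝒢.unit x) := 𝒢.diagCoeff_regularRep f x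

open MeasureTheory in
/-- `M(G)`: the invariant regular Borel probability measures on `G⁽⁰⁾`, with the weak⋆ topology
inherited from `FiniteMeasure X`. -/
def invariantMeasures {X G : Type*} [TopologicalSpace X] [TopologicalSpace G]
    [MeasurableSpace X] [BorelSpace X] (𝒢 : EtaleGroupoid X G) : Set (FiniteMeasure X) :=
  {μ | IsProbabilityMeasure (μ : Measure X) ∧ (μ : Measure X).Regular ∧
    ∀ V : Set G, IsOpen V → 𝒢.IsBisection V →
      (μ : Measure X) (𝒢.src '' V) = (μ : Measure X) (𝒢.rng '' V)}

end EtaleGroupoid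

open scoped ComplexOrder in
/-- The tracial states of a unital C⋆-algebra, with the weak⋆ topology inherited from the dual. -/
def tracialStates (A : Type*) [NormedRing A] [StarRing A] [NormedAlgebra ℂ A] :
    Set (WeakDual ℂ A) :=
  {τ | τ 1 = 1 ∧ (∀ a, 0 ≤ τ (star a * a)) ∧ ∀ a b, τ (a * b) = τ (b * a)}

end

noncomputable section

open Set Filter Topology MeasureTheory
open scoped CompactlySupported ComplexOrder

namespace EtaleGroupoid

variable {X G : Type*} [TopologicalSpace X] [TopologicalSpace G] (𝒢 : EtaleGroupoid X G)

/-! Topology of ample groupoids -/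

/-! A trace does not see off-diagonal arrows. If r(a) ≠ s(a), a clopen set P containing r(a) but not
s(a) gives g = 1_P g and g 1_P = 0 for every g supported near a, so τ(g) = τ(g 1_P) = 0
(`map_ofCc_eq_zero`). Only isotropy outside the units could therefore break τ = τ ∘ E, and an
elementary subgroupoid K has none, being principal (`map_ofCc_eq_map_expectation`).

For f in C_c(G) supported in a compact open set C, choose K almost invariant under C and split f =
1_K f + 1_{K^c} f. The first summand has the right trace. The second is unchanged by right
multiplication with 1_D, D = s(C \ K), so Cauchy–Schwarz bounds its trace by a constant independent
of K times τ(1_D)^(1/2). Averaging 1_D over K-orbits does not change its trace, and invariance says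
that D meets each orbit in a small proportion, so τ(1_D) ≤ Nε (`re_map_charFn_le`,
`ncard_composablePairs_le`). Letting ε tend to 0 and using density gives `map_eq_map_expectation`.

Traces and measures are matched by one identity: E(fg) and E(gf) are the sums of the same function f
· `flip` g over range fibres and over source fibres. Traciality of L ∘ E thus means that L gives
both fibre sums the same value. For a measure this is invariance under bisections, one direction by
localising to a compact open bisection (`integral_rngSum_flip`), the other by testing on indicators
(`measure_src_eq_measure_rng`). Riesz–Markov then gives the inverse bijections of `traceHomeomorph`.

Traces exist because averages over the K-orbits of a point are almost invariant states, and any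
weak* cluster point along increasing compact sets and decreasing ε is invariant
(`exists_invariant_state`). The tracial states form a compact set, so Krein–Milman supplies extreme
points, and the affine bijection carries them to the measures. -/

lemma isOpenMap_rng : IsOpenMap 𝒢.rng := fun U hU => by
  have h : 𝒢.rng '' U = 𝒢.unit ⁻¹' ((fun a => 𝒢.unit (𝒢.rng a)) '' U) := by
    ext x
    constructor
    · rintro ⟨a, ha, rfl⟩
      exact ⟨a, ha, rfl⟩
    · rintro ⟨a, ha, h⟩
      exact ⟨a, ha, 𝒢.unit_injective h⟩
  rw [h]
  exact (𝒢.etale.isOpenMap U hU).preimage 𝒢.continuous_unit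

/-- Inversion as a homeomorphism. -/
def invHomeomorph : G ≃ₜ G where
  toFun := 𝒢.inv
  invFun := 𝒢.inv
  left_inv := 𝒢.inv_inv
  right_inv := 𝒢.inv_inv
  continuous_toFun := 𝒢.continuous_inv
  continuous_invFun := 𝒢.continuous_inv

lemma isOpenMap_src : IsOpenMap 𝒢.src := by
  have h : 𝒢.src = 𝒢.rng ∘ 𝒢.invHomeomorph := funext fun a => (𝒢.rng_inv a).symm
  rw [h]
  exact 𝒢.isOpenMap_rng.comp 𝒢.invHomeomorph.isOpenMap

lemma exists_isOpen_injOn_rng (a : G) : ∃ U, IsOpen U ∧ a ∈ U ∧ InjOn 𝒢.rng U := by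
  obtain ⟨U, V, σ, hU, haU, -, -, -, -, h⟩ := 𝒢.exists_local_section a univ isOpen_univ trivial
  refine ⟨U, hU, haU, fun b hb c hc hbc => ?_⟩
  rw [← (h b hb).2, ← (h c hc).2, hbc]

lemma exists_isOpen_injOn_src (a : G) : ∃ U, IsOpen U ∧ a ∈ U ∧ InjOn 𝒢.src U := by
  obtain ⟨U, hU, ha, hi⟩ := 𝒢.exists_isOpen_injOn_rng (𝒢.inv a)
  refine ⟨𝒢.inv ⁻¹' U, hU.preimage 𝒢.continuous_inv, ha, fun b hb c hc hbc => ?_⟩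
  exact 𝒢.invHomeomorph.injective (hi hb hc ((𝒢.rng_inv b).trans (hbc.trans (𝒢.rng_inv c).symm)))

lemma isBisection_of_injOn {U : Set G} (hU : IsOpen U) (hs : InjOn 𝒢.src U)
    (hr : InjOn 𝒢.rng U) : 𝒢.IsBisection U :=
  ⟨(IsOpenEmbedding.of_continuous_injective_isOpenMap
      (𝒢.continuous_src.comp continuous_subtype_val) (injOn_iff_injective.1 hs)
      (𝒢.isOpenMap_src.comp hU.isOpenMap_subtype_val)).isEmbedding,
    (IsOpenEmbedding.of_continuous_injective_isOpenMap
      (𝒢.continuous_rng.comp continuous_subtype_val) (injOn_iff_injective.1 hr)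
      (𝒢.isOpenMap_rng.comp hU.isOpenMap_subtype_val)).isEmbedding⟩

variable {𝒢} in
lemma _root_.TopGroupoid.IsBisection.injOn_src {U : Set G} (h : 𝒢.IsBisection U) : InjOn 𝒢.src U :=
  injOn_iff_injective.2 h.1.injective

variable {𝒢} in
lemma _root_.TopGroupoid.IsBisection.injOn_rng {U : Set G} (h : 𝒢.IsBisection U) : InjOn 𝒢.rng U :=
  injOn_iff_injective.2 h.2.injective

/-- A connected set has a single range, and range fibres are discrete because r is locally
injective; a connected discrete set has at most one point. -/
lemma totallyDisconnectedSpace [T2Space G] (h : 𝒢.IsAmple) : TotallyDisconnectedSpace G := by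
  have : TotallyDisconnectedSpace X := h
  refine ⟨fun S _ hS => ?_⟩
  have hr : (𝒢.rng '' S).Subsingleton :=
    (hS.image _ 𝒢.continuous_rng.continuousOn).subsingleton
  have hd : DiscreteTopology S := by
    refine discreteTopology_iff_isOpen_singleton.2 fun a => ?_
    obtain ⟨U, hU, ha, hi⟩ := 𝒢.exists_isOpen_injOn_rng a
    convert hU.preimage (continuous_subtype_val (p := (· ∈ S)))
    ext b
    constructor
    · rintro rfl; exact ha
    · exact fun hb => Subtype.ext
        (hi hb ha (hr (mem_image_of_mem _ b.2) (mem_image_of_mem _ a.2)))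
  have := isPreconnected_iff_preconnectedSpace.1 hS
  exact subsingleton_coe _ |>.1 PreconnectedSpace.trivial_of_discrete

lemma exists_compact_open [T2Space G] [LocallyCompactSpace G] (h : 𝒢.IsAmple) {a : G}
    {U : Set G} (hU : IsOpen U) (ha : a ∈ U) :
    ∃ V, IsCompact V ∧ IsOpen V ∧ a ∈ V ∧ V ⊆ U := by
  have := 𝒢.totallyDisconnectedSpace h
  obtain ⟨K, hK, haK, hKU⟩ := exists_compact_subset hU ha
  obtain ⟨V, hV, haV, hVK⟩ :=
    loc_compact_Haus_tot_disc_of_zero_dim.exists_subset_of_mem_open haK isOpen_interior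
  exact ⟨V, hK.of_isClosed_subset hV.1 (hVK.trans interior_subset), hV.2, haV,
    hVK.trans (interior_subset.trans hKU)⟩

lemma exists_compact_open_superset [T2Space G] [LocallyCompactSpace G] (h : 𝒢.IsAmple)
    {S U : Set G} (hS : IsCompact S) (hU : IsOpen U) (hSU : S ⊆ U) :
    ∃ V, IsCompact V ∧ IsOpen V ∧ S ⊆ V ∧ V ⊆ U := by
  refine hS.induction_on (p := fun S => ∃ V, IsCompact V ∧ IsOpen V ∧ S ⊆ V ∧ V ⊆ U)
    ⟨∅, isCompact_empty, isOpen_empty, Subset.rfl, empty_subset _⟩ ?_ ?_ ?_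
  · rintro s t hst ⟨V, h1, h2, h3, h4⟩
    exact ⟨V, h1, h2, hst.trans h3, h4⟩
  · rintro s t ⟨V, h1, h2, h3, h4⟩ ⟨W, k1, k2, k3, k4⟩
    exact ⟨V ∪ W, h1.union k1, h2.union k2, union_subset_union h3 k3, union_subset h4 k4⟩
  · intro a ha
    obtain ⟨V, h1, h2, h3, h4⟩ := 𝒢.exists_compact_open h hU (hSU ha)
    exact ⟨V, mem_nhdsWithin_of_mem_nhds (h2.mem_nhds h3), V, h1, h2, Subset.rfl, h4⟩

lemma exists_compact_open_bisection [T2Space G] [LocallyCompactSpace G] (h : 𝒢.IsAmple) (a : G) :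
    ∃ V, IsCompact V ∧ IsOpen V ∧ a ∈ V ∧ 𝒢.IsBisection V := by
  obtain ⟨U, hU, haU, hUi⟩ := 𝒢.exists_isOpen_injOn_rng a
  obtain ⟨W, hW, haW, hWi⟩ := 𝒢.exists_isOpen_injOn_src a
  obtain ⟨V, h1, h2, h3, h4⟩ := 𝒢.exists_compact_open h (hU.inter hW) ⟨haU, haW⟩
  exact ⟨V, h1, h2, h3, 𝒢.isBisection_of_injOn h2 (hWi.mono (h4.trans inter_subset_right))
    (hUi.mono (h4.trans inter_subset_left))⟩

end EtaleGroupoid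

/-! Indicator functions of clopen sets -/

/-- The indicator function of a clopen set. -/
def IsClopen.charFn {Y : Type*} [TopologicalSpace Y] {U : Set Y} (hU : IsClopen U) : C(Y, ℂ) where
  toFun := U.indicator fun _ => 1
  continuous_toFun := continuous_const.indicator (by simp [hU.frontier_eq])

lemma IsClopen.charFn_mem {Y : Type*} [TopologicalSpace Y] {U : Set Y} (hU : IsClopen U) {y : Y}
    (hy : y ∈ U) : hU.charFn y = 1 := indicator_of_mem hy fun _ => (1 : ℂ)

lemma IsClopen.charFn_notMem {Y : Type*} [TopologicalSpace Y] {U : Set Y} (hU : IsClopen U)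
    {y : Y} (hy : y ∉ U) : hU.charFn y = 0 := indicator_of_notMem hy fun _ => (1 : ℂ)

/-- The indicator function of a compact open set. -/
def indicatorCc {Y : Type*} [TopologicalSpace Y] [T2Space Y] {U : Set Y} (hU : IsCompact U)
    (hU' : IsOpen U) : C_c(Y, ℂ) where
  toContinuousMap := IsClopen.charFn ⟨hU.isClosed, hU'⟩
  hasCompactSupport' := HasCompactSupport.intro hU fun _ ha => indicator_of_notMem ha fun _ => (1 : ℂ)

lemma indicatorCc_mem {Y : Type*} [TopologicalSpace Y] [T2Space Y] {U : Set Y} (hU : IsCompact U)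
    (hU' : IsOpen U) {y : Y} (hy : y ∈ U) : indicatorCc hU hU' y = 1 :=
  indicator_of_mem hy fun _ => (1 : ℂ)

lemma indicatorCc_notMem {Y : Type*} [TopologicalSpace Y] [T2Space Y] {U : Set Y}
    (hU : IsCompact U) (hU' : IsOpen U) {y : Y} (hy : y ∉ U) : indicatorCc hU hU' y = 0 :=
  indicator_of_notMem hy fun _ => (1 : ℂ)

lemma smul_charFn_add_compl {Y : Type*} [TopologicalSpace Y] {U : Set Y}
    (hU : IsClopen U) (f : C_c(Y, ℂ)) : hU.charFn • f + hU.compl.charFn • f = f := by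
  ext y
  by_cases hy : y ∈ U
  · simp [hU.charFn_mem hy, hU.compl.charFn_notMem (not_not.2 hy)]
  · simp [hU.charFn_notMem hy, hU.compl.charFn_mem hy]

/-- A linear functional on `C_c(Y)` that vanishes locally on a compact set vanishes on the
functions supported there. -/
lemma eq_zero_of_locally_eq_zero {Y : Type*} [TopologicalSpace Y] (L : C_c(Y, ℂ) →ₗ[ℂ] ℂ)
    {S : Set Y} (hS : IsCompact S)
    (h : ∀ a ∈ S, ∃ U, IsClopen U ∧ a ∈ U ∧ ∀ f : C_c(Y, ℂ), (∀ b ∉ U, f b = 0) →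
      (∀ b ∉ S, f b = 0) → L f = 0)
    (f : C_c(Y, ℂ)) (hf : ∀ b ∉ S, f b = 0) : L f = 0 := by
  obtain ⟨U, hU, hSU, hUf⟩ := hS.induction_on (p := fun T => ∃ U, IsClopen U ∧ T ⊆ U ∧
      ∀ f : C_c(Y, ℂ), (∀ b ∉ U, f b = 0) → (∀ b ∉ S, f b = 0) → L f = 0)
    ⟨∅, isClopen_empty, Subset.rfl, fun f hf _ => by
      rw [show f = 0 from CompactlySupportedContinuousMap.ext fun b => hf b (notMem_empty b),
        map_zero]⟩
    (fun s t hst ⟨U, h1, h2, h3⟩ => ⟨U, h1, hst.trans h2, h3⟩)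
    (fun s t ⟨U, h1, h2, h3⟩ ⟨V, k1, k2, k3⟩ => ⟨U ∪ V, h1.union k1, union_subset_union h2 k2, by
      intro f hf hfS
      -- Cutting along the clopen set U leaves one piece supported in U and another supported in V,
      -- both still vanishing off S.
      rw [← smul_charFn_add_compl h1 f, map_add, h3, k3, add_zero]
      · intro b hb
        by_cases hbU : b ∈ U
        · simp [h1.compl.charFn_notMem (not_not.2 hbU)]
        · simp [hf b (by simp [hb, hbU])]
      · intro b hb
        simp [hfS b hb]
      · intro b hb
        simp [h1.charFn_notMem hb]
      · intro b hb
        simp [hfS b hb]⟩)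
    (fun a ha => by
      obtain ⟨U, h1, h2, h3⟩ := h a ha
      exact ⟨U, mem_nhdsWithin_of_mem_nhds (h1.2.mem_nhds h2), U, h1, Subset.rfl, h3⟩)
  exact hUf f (fun b hb => hf b fun h => hb (hSU h)) hf

lemma finsum_cond_eq_apply {α M : Type*} [AddCommMonoid M] {p : α → Prop} {g : α → M} {a : α}
    (ha : p a) (h : ∀ b, p b → b ≠ a → g b = 0) : ∑ᶠ (b : α) (_ : p b), g b = g a := by
  classical
  simp only [finsum_eq_if]
  rw [finsum_eq_single _ a, if_pos ha]
  intro b hb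
  split_ifs with hp
  exacts [h b hp hb, rfl]

namespace EtaleGroupoid

variable {X G : Type*} [TopologicalSpace X] [TopologicalSpace G] (𝒢 : EtaleGroupoid X G)

/-! Fibre sums and the expectation of products -/

/-- The function `a ↦ f(a⁻¹)`. -/
def flip : C_c(G, ℂ) →ₗ[ℂ] C_c(G, ℂ) where
  toFun f :=
    { toFun := fun a => f (𝒢.inv a)
      continuous_toFun := f.continuous.comp 𝒢.continuous_inv
      hasCompactSupport' := f.hasCompactSupport.comp_homeomorph 𝒢.invHomeomorph }
  map_add' _ _ := rfl
  map_smul' _ _ := rfl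

@[simp] lemma flip_apply (f : C_c(G, ℂ)) (a : G) : 𝒢.flip f a = f (𝒢.inv a) := rfl

@[simp] lemma flip_flip (f : C_c(G, ℂ)) : 𝒢.flip (𝒢.flip f) = f := by
  ext a
  simp [𝒢.inv_inv]

lemma finite_rng_inter_support (f : C_c(G, ℂ)) (x : X) :
    ({a | 𝒢.rng a = x} ∩ Function.support f).Finite := by
  obtain ⟨N, hN⟩ := 𝒢.exists_rng_fiber_bound f.hasCompactSupport.isCompact
  exact (finite_of_encard_le_coe (hN x)).subset fun a ha => ⟨subset_tsupport _ ha.2, ha.1⟩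

lemma kernel_ne_zero {f : C_c(G, ℂ)} {a b : G}
    (h : 𝒢.kernel f a b ≠ 0) : 𝒢.src a = 𝒢.src b ∧ f (𝒢.mul a (𝒢.inv b)) ≠ 0 := by
  unfold kernel at h
  split_ifs at h with h'
  · exact ⟨h', h⟩
  · exact absurd rfl h

variable [T2Space G]

/-- The fibre sum `x ↦ ∑ f(a)` over `a` with `r(a) = x`. -/
def rngSum : C_c(G, ℂ) →ₗ[ℂ] C(X, ℂ) where
  toFun f :=
    { toFun := fun x => ∑ᶠ (a : G) (_ : 𝒢.rng a = x), f a
      continuous_toFun := 𝒢.continuous_fiber_sum continuous_id f.hasCompactSupport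
        (fun a _ => f a) (fun a _ _ ha => image_eq_zero_of_notMem_tsupport ha)
        (f.continuous.comp continuous_fst).continuousOn }
  map_add' f g := by
    ext x
    exact finsum_mem_add_distrib' (𝒢.finite_rng_inter_support f x)
      (𝒢.finite_rng_inter_support g x)
  map_smul' c f := by
    ext x
    change (∑ᶠ (a : G) (_ : 𝒢.rng a = x), c • f a) = c • ∑ᶠ (a : G) (_ : 𝒢.rng a = x), f a
    rw [smul_finsum]
    exact finsum_congr fun a => (smul_finsum c _).symm

lemma rngSum_apply (f : C_c(G, ℂ)) (x : X) :
    𝒢.rngSum f x = ∑ᶠ (a : G) (_ : 𝒢.rng a = x), f a := rfl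

lemma rngSum_flip_apply (f : C_c(G, ℂ)) (x : X) :
    𝒢.rngSum (𝒢.flip f) x = ∑ᶠ (a : G) (_ : 𝒢.src a = x), f a := by
  rw [rngSum_apply]
  refine finsum_mem_eq_of_bijOn (s := {a | 𝒢.rng a = x}) (t := {a | 𝒢.src a = x}) 𝒢.inv
    ⟨fun a ha => (𝒢.src_inv a).trans ha, 𝒢.invHomeomorph.injective.injOn, fun a ha =>
      ⟨𝒢.inv a, (𝒢.rng_inv a).trans ha, 𝒢.inv_inv a⟩⟩ fun a _ => rfl

/-- At a unit the second factor of the convolution is evaluated at a⁻¹. This turns the expectation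
of a product into a fibre sum of one pointwise product. -/
lemma conv_unit (f g : C_c(G, ℂ)) (x : X) :
    𝒢.conv f g (𝒢.unit x) = 𝒢.rngSum (f * 𝒢.flip g) x := by
  change (∑ᶠ (a : G) (_ : 𝒢.rng a = 𝒢.rng (𝒢.unit x)), f a * g (𝒢.mul (𝒢.inv a) (𝒢.unit x))) = _
  rw [𝒢.rng_unit]
  refine finsum_mem_congr (s := {a | 𝒢.rng a = x}) rfl fun a ha => ?_
  have := 𝒢.mul_unit (𝒢.inv a)
  rw [𝒢.src_inv, show 𝒢.rng a = x from ha] at this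
  rw [this]
  rfl

variable [CompactSpace X]

/-- The inclusion of `C_c(G)` into `C_r^*(G)` as a linear map. -/
def ofCcₗ : C_c(G, ℂ) →ₗ[ℂ] 𝒢.reducedAlgebra where
  toFun := 𝒢.ofCc
  map_add' _ _ := Subtype.ext (map_add _ _ _)
  map_smul' _ _ := Subtype.ext (map_smul _ _ _)

@[simp] lemma ofCcₗ_apply (f : C_c(G, ℂ)) : 𝒢.ofCcₗ f = 𝒢.ofCc f := rfl

/-- The inclusion of `C(G⁽⁰⁾)` into `C_r^*(G)` as a linear map. -/
def ofUnitsₗ : C(X, ℂ) →ₗ[ℂ] 𝒢.reducedAlgebra where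
  toFun := 𝒢.ofUnits
  map_add' φ ψ := by
    rw [ofUnits, ofUnits, ofUnits, ← ofCcₗ_apply, ← ofCcₗ_apply, ← ofCcₗ_apply, ← map_add]
    congr 1
    ext a
    exact congrFun (indicator_add (range 𝒢.unit) (φ ∘ 𝒢.src) (ψ ∘ 𝒢.src)) a
  map_smul' c φ := by
    rw [ofUnits, ofUnits, ← ofCcₗ_apply, ← ofCcₗ_apply, RingHom.id_apply, ← map_smul]
    congr 1
    ext a
    exact congrFun (indicator_const_smul (range 𝒢.unit) c (φ ∘ 𝒢.src)) a

@[simp] lemma ofUnitsₗ_apply (φ : C(X, ℂ)) : 𝒢.ofUnitsₗ φ = 𝒢.ofUnits φ := rfl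

lemma ofUnits_one : 𝒢.ofUnits 1 = 1 := Subtype.ext 𝒢.regularRep_one

lemma ofCc_mul_ofCc (f g : C_c(G, ℂ)) : 𝒢.ofCc f * 𝒢.ofCc g = 𝒢.ofCc (𝒢.conv f g) :=
  Subtype.ext (𝒢.regularRep_conv f g).symm

lemma star_ofCc (f : C_c(G, ℂ)) : star (𝒢.ofCc f) = 𝒢.ofCc (𝒢.involution f) :=
  Subtype.ext (𝒢.regularRep_involution f).symm

lemma extendUnits_unit (φ : C(X, ℂ)) (x : X) : 𝒢.extendUnits φ (𝒢.unit x) = φ x :=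
  (indicator_of_mem (mem_range_self x) fun a => φ (𝒢.src a)).trans (by rw [𝒢.src_unit])

lemma extendUnits_notMem (φ : C(X, ℂ)) {a : G} (ha : a ∉ range 𝒢.unit) :
    𝒢.extendUnits φ a = 0 :=
  indicator_of_notMem ha fun a => φ (𝒢.src a)

lemma expectation_ofUnits (φ : C(X, ℂ)) : 𝒢.expectation (𝒢.ofUnits φ) = φ := by
  ext x
  exact (𝒢.expectation_ofCc _ x).trans (𝒢.extendUnits_unit φ x)

lemma expectation_ofCc_mul_ofCc (f g : C_c(G, ℂ)) :
    𝒢.expectation (𝒢.ofCc f * 𝒢.ofCc g) = 𝒢.rngSum (f * 𝒢.flip g) := by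
  ext x
  rw [ofCc_mul_ofCc, expectation_ofCc, conv_unit]

/-- Pointwise, g · `flip` f is the flip of f · `flip` g. Exchanging the factors of a product
therefore amounts to exchanging range sums with source sums. -/
lemma expectation_ofCc_mul_ofCc_swap (f g : C_c(G, ℂ)) :
    𝒢.expectation (𝒢.ofCc g * 𝒢.ofCc f) = 𝒢.rngSum (𝒢.flip (f * 𝒢.flip g)) := by
  rw [expectation_ofCc_mul_ofCc]
  congr 1
  ext a
  simp [𝒢.inv_inv, mul_comm]

/-- `C_c(G)` is dense in the reduced algebra. -/
lemma denseRange_ofCc : DenseRange 𝒢.ofCc := by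
  intro a
  refine Metric.mem_closure_iff.2 fun ε hε => ?_
  obtain ⟨_, ⟨f, rfl⟩, hf⟩ := Metric.mem_closure_iff.1 a.2 ε hε
  exact ⟨_, ⟨f, rfl⟩, hf⟩

lemma extendUnits_conv (φ : C(X, ℂ)) (f : C_c(G, ℂ)) (a : G) :
    𝒢.conv (𝒢.extendUnits φ) f a = φ (𝒢.rng a) * f a := by
  change (∑ᶠ (b : G) (_ : 𝒢.rng b = 𝒢.rng a), 𝒢.extendUnits φ b * f (𝒢.mul (𝒢.inv b) a)) = _
  rw [finsum_cond_eq_apply (p := fun b => 𝒢.rng b = 𝒢.rng a) (a := 𝒢.unit (𝒢.rng a))]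
  · rw [extendUnits_unit, 𝒢.inv_unit, 𝒢.unit_mul]
  · exact 𝒢.rng_unit _
  · rintro b hb hne
    rw [extendUnits_notMem, zero_mul]
    rintro ⟨x, rfl⟩
    rw [𝒢.rng_unit] at hb
    exact hne (by rw [hb])

lemma conv_extendUnits (φ : C(X, ℂ)) (f : C_c(G, ℂ)) (a : G) :
    𝒢.conv f (𝒢.extendUnits φ) a = f a * φ (𝒢.src a) := by
  change (∑ᶠ (b : G) (_ : 𝒢.rng b = 𝒢.rng a), f b * 𝒢.extendUnits φ (𝒢.mul (𝒢.inv b) a)) = _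
  rw [finsum_cond_eq_apply (p := fun b => 𝒢.rng b = 𝒢.rng a) (a := a)]
  · rw [𝒢.inv_mul, extendUnits_unit]
  · exact rfl
  · rintro b hb hne
    rw [extendUnits_notMem, mul_zero]
    rintro ⟨x, hx⟩
    have h1 := 𝒢.inv_mul_cancel_left b a hb
    have h2 := 𝒢.rng_mul (𝒢.inv b) a (by rw [𝒢.src_inv]; exact hb)
    rw [← hx, 𝒢.rng_unit, 𝒢.rng_inv] at h2
    rw [← hx, h2, 𝒢.mul_unit] at h1
    exact hne h1

lemma ofUnits_mul (φ ψ : C(X, ℂ)) : 𝒢.ofUnits (φ * ψ) = 𝒢.ofUnits φ * 𝒢.ofUnits ψ := by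
  rw [ofUnits, ofUnits, ofUnits, ofCc_mul_ofCc]
  congr 1
  ext a
  rw [extendUnits_conv]
  by_cases ha : a ∈ range 𝒢.unit
  · obtain ⟨x, rfl⟩ := ha
    simp [extendUnits_unit, 𝒢.rng_unit]
  · simp [extendUnits_notMem _ _ ha]

lemma star_ofUnits (φ : C(X, ℂ)) : star (𝒢.ofUnits φ) = 𝒢.ofUnits (star φ) := by
  rw [ofUnits, ofUnits, star_ofCc]
  congr 1
  ext a
  change starRingEnd ℂ (𝒢.extendUnits φ (𝒢.inv a)) = _
  by_cases ha : a ∈ range 𝒢.unit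
  · obtain ⟨x, rfl⟩ := ha
    simp [extendUnits_unit, 𝒢.inv_unit]
  · rw [extendUnits_notMem _ _ ha, extendUnits_notMem, map_zero]
    rintro ⟨x, hx⟩
    exact ha ⟨x, by rw [← 𝒢.inv_unit, hx, 𝒢.inv_inv]⟩

/-- The bound depends only on the band constants, hence it stays uniform when a function is cut down
to varying clopen sets. -/
lemma norm_ofCc_le {f : C_c(G, ℂ)} {N : ℕ} {M : ℝ} (h : IsBandKernel (𝒢.kernel f) N M)
    (hM : 0 ≤ M) : ‖𝒢.ofCc f‖ ≤ N * M := by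
  classical
  have e : 𝒢.regularRep f = h.op hM := EllTwo.ext_op fun a c => by
    rw [regularRep_apply, IsBandKernel.op_apply]
  change ‖𝒢.regularRep f‖ ≤ _
  rw [e]
  exact LinearMap.mkContinuous_norm_le _ (by positivity) _

lemma norm_ofUnits_le (φ : C(X, ℂ)) : ‖𝒢.ofUnits φ‖ ≤ ‖φ‖ := by
  have key : ∀ a b, 𝒢.kernel (𝒢.extendUnits φ) a b ≠ 0 → a = b := by
    intro a b h
    obtain ⟨h1, h2⟩ := 𝒢.kernel_ne_zero h
    refine (𝒢.mul_inv_self_iff a b h1).1 ?_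
    by_contra h3
    exact h2 (𝒢.extendUnits_notMem φ h3)
  have h : IsBandKernel (𝒢.kernel (𝒢.extendUnits φ)) 1 ‖φ‖ := by
    refine ⟨fun a => ?_, fun b => ?_, fun a b => ?_⟩
    · rw [Nat.cast_one, encard_le_one_iff]
      exact fun b c hb hc => (key a b hb).symm.trans (key a c hc)
    · rw [Nat.cast_one, encard_le_one_iff]
      exact fun a c ha hc => (key a b ha).trans (key c b hc).symm
    · unfold kernel
      split_ifs
      · by_cases hm : 𝒢.mul a (𝒢.inv b) ∈ range 𝒢.unit
        · obtain ⟨x, hx⟩ := hm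
          rw [← hx, extendUnits_unit]
          exact φ.norm_coe_le_norm x
        · rw [extendUnits_notMem _ _ hm]
          simp
      · simp
  exact (𝒢.norm_ofCc_le h (norm_nonneg _)).trans_eq (by rw [Nat.cast_one, one_mul])

lemma continuous_ofUnits : Continuous 𝒢.ofUnits :=
  (LinearMap.mkContinuous 𝒢.ofUnitsₗ 1 fun φ => by
    simpa using 𝒢.norm_ofUnits_le φ).continuous

lemma norm_expectation_le (a : 𝒢.reducedAlgebra) : ‖𝒢.expectation a‖ ≤ ‖a‖ :=
  (ContinuousMap.norm_le _ (norm_nonneg _)).2 fun x => 𝒢.norm_diagCoeff_le a x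

lemma expectation_one : 𝒢.expectation 1 = 1 := by
  rw [← ofUnits_one, expectation_ofUnits]

/-- The diagonal coefficient of a⋆a at x is ‖a δₓ‖². -/
lemma expectation_star_mul_self (a : 𝒢.reducedAlgebra) (x : X) :
    ∃ r : ℝ, 0 ≤ r ∧ 𝒢.expectation (star a * a) x = r := by
  classical
  set δ : EllTwo G := lp.single 2 (𝒢.unit x) (1 : ℂ)
  set T : EllTwo G →L[ℂ] EllTwo G := a.1 with hT
  refine ⟨‖T δ‖ ^ 2, by positivity, ?_⟩
  change (star T * T) δ (𝒢.unit x) = _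
  have h1 := lp.inner_single_left (𝕜 := ℂ) (𝒢.unit x) (1 : ℂ) ((star T * T) δ)
  rw [ContinuousLinearMap.star_eq_adjoint, mul_apply_eq_comp,
    ContinuousLinearMap.adjoint_inner_right, inner_self_eq_norm_sq_to_K] at h1
  rw [ContinuousLinearMap.star_eq_adjoint, mul_apply_eq_comp]
  simpa using h1.symm

end EtaleGroupoid

namespace EtaleGroupoid

variable {X G : Type*} [TopologicalSpace X] [TopologicalSpace G] (𝒢 : EtaleGroupoid X G)

/-! Counting in elementary subgroupoids -/

lemma finite_fiber {K : Set G} (hK : IsCompact K) (x : X) : (𝒢.fiber K x).Finite := by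
  obtain ⟨N, hN⟩ := 𝒢.exists_src_fiber_bound hK
  exact finite_of_encard_le_coe (hN x)

/-- The pairs `(c, k)` of composable elements with `c ∈ C` and `k ∈ K x`. -/
def composablePairs (C K : Set G) (x : X) : Set (G × G) :=
  {p | p.1 ∈ C ∧ p.2 ∈ 𝒢.fiber K x ∧ 𝒢.src p.1 = 𝒢.rng p.2}

lemma finite_composablePairs {C K : Set G} (hC : IsCompact C) (hK : IsCompact K) (x : X) :
    (𝒢.composablePairs C K x).Finite := by
  refine ((𝒢.finite_fiber hK x).biUnion fun k _ =>
    (𝒢.finite_fiber hC (𝒢.rng k)).prod (finite_singleton k)).subset ?_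
  rintro ⟨c, k⟩ ⟨h1, h2, h3⟩
  exact mem_biUnion h2 ⟨⟨h1, h3⟩, rfl⟩

lemma finite_fiber_setMul {C K : Set G} (hC : IsCompact C) (hK : IsCompact K) (x : X) :
    (𝒢.fiber (𝒢.setMul C K) x).Finite := by
  refine ((𝒢.finite_composablePairs hC hK x).image fun p => 𝒢.mul p.1 p.2).subset ?_
  rintro _ ⟨⟨c, hc, k, hk, hck, rfl⟩, hx⟩
  exact ⟨(c, k), ⟨hc, ⟨hk, by rw [← hx, 𝒢.src_mul _ _ hck]⟩, hck⟩, rfl⟩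

variable {𝒢} in
lemma _root_.TopGroupoid.IsInvariantFor.mono {C C' K : Set G} {ε : ℝ}
    (h : 𝒢.IsInvariantFor C ε K) (hC : IsCompact C) (hK : IsCompact K) (hC' : C' ⊆ C) :
    𝒢.IsInvariantFor C' ε K := by
  refine fun x => lt_of_le_of_lt ?_ (h x)
  refine div_le_div_of_nonneg_right (Nat.cast_le.2 ?_) (Nat.cast_nonneg _)
  refine ncard_le_ncard (sdiff_subset_sdiff_left ?_) (𝒢.finite_fiber_setMul hC hK x).sdiff
  rintro _ ⟨⟨c, hc, k, hk, hck, rfl⟩, hx⟩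
  exact ⟨⟨c, hC' hc, k, hk, hck, rfl⟩, hx⟩

variable {𝒢} in
lemma _root_.TopGroupoid.IsElementary.fiber_ncard_pos {K : Set G} (hK : 𝒢.IsElementary K) (x : X) :
    0 < (𝒢.fiber K x).ncard :=
  (ncard_pos (𝒢.finite_fiber hK.isCompact x)).2 ⟨𝒢.unit x, hK.unit_mem x, 𝒢.src_unit x⟩

/-- Multiplication sends a pair (c, k) with c ∉ K into C K x \ K x, since ck ∈ K would force c =
(ck)k⁻¹ ∈ K. A product d has at most N preimages: c lies in C with range r(d), and c and d determine
k. -/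
lemma ncard_composablePairs_le {C K : Set G} (hC : IsCompact C) (hK : 𝒢.IsElementary K)
    {ε : ℝ} (h : 𝒢.IsInvariantFor C ε K) {N : ℕ} (hN : ∀ x, {a ∈ C | 𝒢.rng a = x}.encard ≤ N)
    (x : X) :
    ((𝒢.composablePairs (C \ K) K x).ncard : ℝ) ≤ N * ε * (𝒢.fiber K x).ncard := by
  classical
  have hfin : (𝒢.composablePairs (C \ K) K x).Finite :=
    (𝒢.finite_composablePairs hC hK.isCompact x).subset fun p hp => ⟨hp.1.1, hp.2⟩
  set P := hfin.toFinset with hP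
  have hPm : ∀ p, p ∈ P ↔ (p.1 ∈ C ∧ p.1 ∉ K) ∧ (p.2 ∈ K ∧ 𝒢.src p.2 = x) ∧
      𝒢.src p.1 = 𝒢.rng p.2 := fun p => hfin.mem_toFinset
  have h1 : P.card ≤ N * (P.image fun p => 𝒢.mul p.1 p.2).card := by
    refine Finset.card_le_mul_card_image _ _ fun d _ => ?_
    have hinj : Set.InjOn Prod.fst
        (P.filter (fun p => 𝒢.mul p.1 p.2 = d) : Set (G × G)) := by
      rintro ⟨c, k⟩ hp ⟨c', k'⟩ hp' (hcc : c = c')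
      subst hcc
      simp only [Finset.coe_filter, mem_ofPred_eq, hPm] at hp hp'
      have e1 := 𝒢.mul_inv_cancel_left c k hp.1.2.2
      have e2 := 𝒢.mul_inv_cancel_left c k' hp'.1.2.2
      rw [hp.2] at e1
      rw [hp'.2] at e2
      rw [← e1, ← e2]
    rw [← Finset.card_image_of_injOn hinj]
    have h2 := hN (𝒢.rng d)
    have h3 : ((Finset.image Prod.fst (P.filter fun p => 𝒢.mul p.1 p.2 = d) : Finset G) : Set G) ⊆
        {a ∈ C | 𝒢.rng a = 𝒢.rng d} := by
      intro c hc
      simp only [Finset.coe_image, Finset.coe_filter, mem_image, mem_ofPred_eq, hPm] at hc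
      obtain ⟨p, ⟨h4, h5⟩, rfl⟩ := hc
      exact ⟨h4.1.1, by rw [← h5, 𝒢.rng_mul _ _ h4.2.2]⟩
    have h4 := (encard_le_encard h3).trans h2
    rw [encard_coe_eq_coe_finsetCard] at h4
    exact_mod_cast h4
  have h2 : (P.image fun p => 𝒢.mul p.1 p.2).card ≤
      (𝒢.fiber (𝒢.setMul C K) x \ 𝒢.fiber K x).ncard := by
    rw [← ncard_coe_finset]
    refine ncard_le_ncard ?_ ((𝒢.finite_fiber_setMul hC hK.isCompact x).sdiff)
    intro d hd
    simp only [Finset.coe_image, mem_image, Finset.mem_coe, hPm] at hd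
    obtain ⟨⟨c, k⟩, ⟨⟨h3, h4⟩, ⟨h5, h6⟩, h7⟩, rfl⟩ := hd
    refine ⟨⟨⟨c, h3, k, h5, h7, rfl⟩, by rw [𝒢.src_mul _ _ h7, h6]⟩, fun h8 => h4 ?_⟩
    rw [← 𝒢.mul_mul_inv_cancel c k h7]
    exact hK.mul_mem _ h8.1 _ (hK.inv_mem k h5) (by rw [𝒢.src_mul _ _ h7, 𝒢.rng_inv])
  have hpos : (0 : ℝ) < (𝒢.fiber K x).ncard := by exact_mod_cast hK.fiber_ncard_pos x
  have h3 := (div_lt_iff₀ hpos).1 (h x)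
  rw [ncard_eq_toFinset_card _ hfin, mul_assoc]
  calc (P.card : ℝ) ≤ N * (P.image fun p => 𝒢.mul p.1 p.2).card := by exact_mod_cast h1
    _ ≤ N * (𝒢.fiber (𝒢.setMul C K) x \ 𝒢.fiber K x).ncard := by gcongr
    _ ≤ _ := by gcongr

lemma ncard_composablePairs_eq_sum {C K : Set G} (hC : IsCompact C) (hK : IsCompact K) (x : X) :
    (𝒢.composablePairs C K x).ncard =
      ∑ k ∈ (𝒢.finite_fiber hK x).toFinset, (𝒢.fiber C (𝒢.rng k)).ncard := by
  classical
  have hfin := 𝒢.finite_composablePairs hC hK x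
  rw [ncard_eq_toFinset_card _ hfin, Finset.card_eq_sum_card_fiberwise (f := Prod.snd)
    (t := (𝒢.finite_fiber hK x).toFinset)]
  · refine Finset.sum_congr rfl fun k hk => ?_
    rw [Finite.mem_toFinset] at hk
    rw [← ncard_coe_finset]
    symm
    refine ncard_congr (fun c _ => (c, k)) ?_ (fun c d _ _ h => (Prod.ext_iff.1 h).1) ?_
    · intro c hc
      simp only [Finset.coe_filter, Finite.mem_toFinset, mem_ofPred_eq]
      exact ⟨⟨hc.1, hk, hc.2⟩, trivial⟩
    · rintro ⟨c, k'⟩ hp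
      simp only [Finset.coe_filter, Finite.mem_toFinset, mem_ofPred_eq] at hp
      obtain ⟨⟨h1, h2, h3⟩, rfl⟩ := hp
      exact ⟨c, ⟨h1, h3⟩, rfl⟩
  · intro p hp
    rw [Finite.coe_toFinset] at hp ⊢
    exact hp.2.1

variable [T2Space G]

lemma norm_rngSum_flip_le {f : C_c(G, ℂ)} {C : Set G} (hC : IsCompact C) {B : ℝ}
    (hf : ∀ a ∉ C, f a = 0) (hB : ∀ a, ‖f a‖ ≤ B) (x : X) :
    ‖𝒢.rngSum (𝒢.flip f) x‖ ≤ B * (𝒢.fiber C x).ncard := by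
  have hfin := 𝒢.finite_fiber hC x
  have e : ∑ᶠ (a : G) (_ : 𝒢.src a = x), f a = ∑ a ∈ hfin.toFinset, f a := by
    refine finsum_mem_eq_sum_of_inter_support_eq (s := {a | 𝒢.src a = x}) _ ?_
    ext a
    simp only [mem_inter_iff, Function.mem_support, mem_ofPred_eq, Finite.coe_toFinset]
    refine ⟨fun h => ⟨⟨?_, h.1⟩, h.2⟩, fun h => ⟨h.1.2, h.2⟩⟩
    by_contra h'
    exact h.2 (hf a h')
  rw [rngSum_flip_apply, e, ncard_eq_toFinset_card _ hfin]
  refine (norm_sum_le_of_le _ fun a _ => hB a).trans_eq ?_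
  rw [Finset.sum_const, nsmul_eq_mul, mul_comm]

variable {𝒢} in
/-- Fibre sums of functions supported in an elementary subgroupoid. -/
lemma _root_.TopGroupoid.IsElementary.rngSum_apply {K : Set G} (hK : 𝒢.IsElementary K)
    {f : C_c(G, ℂ)} (hf : ∀ a ∉ K, f a = 0) {k : G} (hk : k ∈ K) :
    𝒢.rngSum f (𝒢.rng k) =
      ∑ l ∈ (𝒢.finite_fiber hK.isCompact (𝒢.src k)).toFinset, f (𝒢.mul k (𝒢.inv l)) := by
  classical
  have hinj : InjOn (fun l => 𝒢.mul k (𝒢.inv l))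
      ((𝒢.finite_fiber hK.isCompact (𝒢.src k)).toFinset : Set G) := by
    intro l hl m hm h
    rw [Finite.coe_toFinset] at hl hm
    have e1 := 𝒢.mul_inv_cancel_left k (𝒢.inv l) (by rw [𝒢.rng_inv, hl.2])
    have e2 := 𝒢.mul_inv_cancel_left k (𝒢.inv m) (by rw [𝒢.rng_inv, hm.2])
    simp only at h
    rw [h, e2] at e1
    exact 𝒢.invHomeomorph.injective e1.symm
  rw [← Finset.sum_image (f := f) hinj, EtaleGroupoid.rngSum_apply]
  refine finsum_mem_eq_sum_of_inter_support_eq (s := {a | 𝒢.rng a = 𝒢.rng k}) _ ?_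
  ext a
  simp only [mem_inter_iff, mem_ofPred_eq, Function.mem_support, Finset.coe_image, mem_image,
    Finite.coe_toFinset]
  -- The inverse of l ↦ k l⁻¹ is a ↦ a⁻¹ k.
  refine ⟨fun ⟨h1, h2⟩ => ⟨⟨𝒢.mul (𝒢.inv a) k, ⟨?_, ?_⟩, ?_⟩, h2⟩, ?_⟩
  · refine hK.mul_mem _ (hK.inv_mem _ ?_) _ hk (by rw [𝒢.src_inv, h1])
    by_contra h
    exact h2 (hf a h)
  · rw [𝒢.src_mul _ _ (by rw [𝒢.src_inv, h1])]
  · rw [𝒢.inv_mul_rev _ _ (by rw [𝒢.src_inv, h1]), 𝒢.inv_inv,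
      𝒢.inv_mul_cancel_left _ _ h1.symm]
  · rintro ⟨⟨l, hl, rfl⟩, h2⟩
    exact ⟨𝒢.rng_mul _ _ (by rw [𝒢.rng_inv, hl.2]), h2⟩

variable {𝒢} in
lemma _root_.TopGroupoid.IsElementary.rngSum_flip_apply {K : Set G} (hK : 𝒢.IsElementary K)
    {f : C_c(G, ℂ)} (hf : ∀ a ∉ K, f a = 0) (x : X) :
    𝒢.rngSum (𝒢.flip f) x = ∑ k ∈ (𝒢.finite_fiber hK.isCompact x).toFinset, f k := by
  have h := hK.rngSum_apply (f := 𝒢.flip f)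
    (fun a ha => hf _ fun h => ha (by rw [← 𝒢.inv_inv a]; exact hK.inv_mem _ h)) (hK.unit_mem x)
  simp only [𝒢.rng_unit, 𝒢.src_unit] at h
  rw [h]
  refine Finset.sum_congr rfl fun k hk => ?_
  rw [Finite.mem_toFinset] at hk
  have := 𝒢.unit_mul (𝒢.inv k)
  rw [𝒢.rng_inv, hk.2] at this
  rw [this, flip_apply, 𝒢.inv_inv]

variable {𝒢} in
/-- The uniform measure on an orbit of `K` is invariant under `K`. -/
lemma _root_.TopGroupoid.IsElementary.sum_rngSum_flip {K : Set G} (hK : 𝒢.IsElementary K)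
    {f : C_c(G, ℂ)} (hf : ∀ a ∉ K, f a = 0) (x : X) :
    ∑ k ∈ (𝒢.finite_fiber hK.isCompact x).toFinset, 𝒢.rngSum (𝒢.flip f) (𝒢.rng k) =
      ∑ k ∈ (𝒢.finite_fiber hK.isCompact x).toFinset, 𝒢.rngSum f (𝒢.rng k) := by
  have hf' : ∀ a ∉ K, 𝒢.flip f a = 0 :=
    fun a ha => hf _ fun h => ha (by rw [← 𝒢.inv_inv a]; exact hK.inv_mem _ h)
  -- Both sides become double sums of g(k l⁻¹) over k, l in K x, and flipping g only exchanges k and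
  -- l.
  have key : ∀ g : C_c(G, ℂ), (∀ a ∉ K, g a = 0) →
      ∑ k ∈ (𝒢.finite_fiber hK.isCompact x).toFinset, 𝒢.rngSum g (𝒢.rng k) =
      ∑ k ∈ (𝒢.finite_fiber hK.isCompact x).toFinset,
        ∑ l ∈ (𝒢.finite_fiber hK.isCompact x).toFinset, g (𝒢.mul k (𝒢.inv l)) := by
    refine fun g hg => Finset.sum_congr rfl fun k hk => ?_
    rw [Finite.mem_toFinset] at hk
    obtain ⟨hk, rfl⟩ := hk
    exact hK.rngSum_apply hg hk
  rw [key _ hf, key _ hf', Finset.sum_comm]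
  refine Finset.sum_congr rfl fun k hk => Finset.sum_congr rfl fun l hl => ?_
  rw [Finite.mem_toFinset] at hk hl
  rw [flip_apply, 𝒢.inv_mul_rev _ _ (by rw [𝒢.rng_inv, hl.2, hk.2]), 𝒢.inv_inv]

end EtaleGroupoid

/-! Positive functionals -/

section Positive

open scoped ComplexOrder

variable {A : Type*} [NormedRing A] [StarRing A] [NormedAlgebra ℂ A] {τ : WeakDual ℂ A}

/-- Polarisation: positivity makes τ(b⋆b) real for b = 1, a, 1 + a and 1 + ia, and the imaginary
parts of these four values determine both components of the claim. -/
lemma map_star_eq_conj [StarModule ℂ A] (h : ∀ a, 0 ≤ τ (star a * a)) (a : A) :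
    τ (star a) = starRingEnd ℂ (τ a) := by
  have him : ∀ a, (τ (star a * a)).im = 0 := fun a => (Complex.le_def.1 (h a)).2.symm
  have h0 := him 1
  have h1 := him a
  have h2 := him (1 + a)
  have h3 := him (1 + Complex.I • a)
  simp only [star_add, star_smul, star_one, add_mul, mul_add, one_mul, mul_one, map_add,
    smul_mul_assoc, mul_smul_comm, map_smul, smul_eq_mul, Complex.add_im, Complex.mul_im,
    Complex.mul_re, Complex.I_re, Complex.I_im, RCLike.star_def, Complex.conj_I,
    Complex.neg_re, Complex.neg_im] at h0 h1 h2 h3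
  apply Complex.ext
  · rw [Complex.conj_re]; linarith
  · rw [Complex.conj_im]; linarith

/-- Cauchy–Schwarz for the semi-inner product (a, b) ↦ τ(a⋆b), which may be degenerate. -/
lemma norm_map_star_mul_sq_le [StarModule ℂ A] (h : ∀ a, 0 ≤ τ (star a * a)) (a b : A) :
    ‖τ (star a * b)‖ ^ 2 ≤ (τ (star a * a)).re * (τ (star b * b)).re := by
  let c : PreInnerProductSpace.Core ℂ A :=
    { inner := fun a b => τ (star a * b)
      conj_inner_symm := fun a b => by
        rw [← map_star_eq_conj h]; simp
      re_inner_nonneg := fun a => (Complex.le_def.1 (h a)).1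
      add_left := fun a b c => by simp [add_mul]
      smul_left := fun a b r => by simp }
  have h1 := InnerProductSpace.Core.inner_mul_inner_self_le (𝕜 := ℂ) (c := c) a b
  have h2 : ‖τ (star b * a)‖ = ‖τ (star a * b)‖ := by
    rw [← RCLike.norm_conj, ← map_star_eq_conj h]; simp
  change ‖τ (star a * b)‖ * ‖τ (star b * a)‖ ≤ _ at h1
  rw [h2, ← sq] at h1
  exact h1

end Positive

/-! ### Traces on functions supported in elementary subgroupoids -/

namespace EtaleGroupoid

variable {X G : Type*} [TopologicalSpace X] [TopologicalSpace G] (𝒢 : EtaleGroupoid X G)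
  [T2Space G] [CompactSpace X]

variable {𝒢} {τ : WeakDual ℂ 𝒢.reducedAlgebra}

/-- The square root ψ of φ is continuous and φ = ψ⋆ψ, so positivity on the algebra applies. -/
lemma map_ofUnits_nonneg (hτ : τ ∈ tracialStates 𝒢.reducedAlgebra) {φ : C(X, ℂ)}
    (hφ : ∀ x, 0 ≤ φ x) : 0 ≤ τ (𝒢.ofUnits φ) := by
  let ψ : C(X, ℂ) := ⟨fun x => (Real.sqrt (φ x).re : ℂ), by fun_prop⟩
  have h : φ = star ψ * ψ := by
    ext x
    have h1 := Complex.le_def.1 (hφ x)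
    simp only [ContinuousMap.mul_apply, ContinuousMap.star_apply, ψ, ContinuousMap.coe_mk,
      RCLike.star_def, Complex.conj_ofReal, ← Complex.ofReal_mul, Real.mul_self_sqrt h1.1]
    exact Complex.ext rfl h1.2.symm
  rw [h, ofUnits_mul, ← star_ofUnits]
  exact hτ.2.1 _

lemma re_map_ofUnits_le (hτ : τ ∈ tracialStates 𝒢.reducedAlgebra) {φ : C(X, ℂ)} {c : ℝ}
    (hφ : ∀ x, φ x ≤ c) : (τ (𝒢.ofUnits φ)).re ≤ c := by
  have h := map_ofUnits_nonneg hτ (φ := (c : ℂ) • 1 - φ) fun x => by simpa using hφ x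
  rw [← ofUnitsₗ_apply, map_sub, map_smul, ofUnitsₗ_apply, ofUnitsₗ_apply, ofUnits_one,
    map_sub, map_smul, hτ.1] at h
  simpa using (Complex.le_def.1 h).1

lemma ofUnits_mul_ofCc_eq_self {φ : C(X, ℂ)} {f : C_c(G, ℂ)}
    (h : ∀ a, f a ≠ 0 → φ (𝒢.rng a) = 1) : 𝒢.ofUnits φ * 𝒢.ofCc f = 𝒢.ofCc f := by
  rw [ofUnits, ofCc_mul_ofCc]
  congr 1
  ext a
  rw [extendUnits_conv]
  by_cases ha : f a = 0
  · rw [ha, mul_zero]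
  · rw [h a ha, one_mul]

lemma ofCc_mul_ofUnits_eq_self {φ : C(X, ℂ)} {f : C_c(G, ℂ)}
    (h : ∀ a, f a ≠ 0 → φ (𝒢.src a) = 1) : 𝒢.ofCc f * 𝒢.ofUnits φ = 𝒢.ofCc f := by
  rw [ofUnits, ofCc_mul_ofCc]
  congr 1
  ext a
  rw [conv_extendUnits]
  by_cases ha : f a = 0
  · rw [ha, zero_mul]
  · rw [h a ha, mul_one]

lemma ofCc_mul_ofUnits_eq_zero {φ : C(X, ℂ)} {f : C_c(G, ℂ)}
    (h : ∀ a, f a ≠ 0 → φ (𝒢.src a) = 0) : 𝒢.ofCc f * 𝒢.ofUnits φ = 0 := by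
  rw [ofUnits, ofCc_mul_ofCc, ← ofCcₗ_apply, show 𝒢.conv f (𝒢.extendUnits φ) = 0 from ?_, map_zero]
  ext a
  rw [conv_extendUnits]
  by_cases ha : f a = 0
  · rw [ha, zero_mul]; rfl
  · rw [h a ha, mul_zero]; rfl

/-- A trace vanishes on functions supported in a compact set of arrows with distinct range and
source. -/
lemma map_ofCc_eq_zero (ha : 𝒢.IsAmple) (hτ : τ ∈ tracialStates 𝒢.reducedAlgebra) {S : Set G}
    (hS : IsCompact S) (hne : ∀ a ∈ S, 𝒢.src a ≠ 𝒢.rng a) {f : C_c(G, ℂ)}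
    (hf : ∀ a ∉ S, f a = 0) : τ (𝒢.ofCc f) = 0 := by
  have := 𝒢.t2Space_units
  have : TotallyDisconnectedSpace X := ha
  refine eq_zero_of_locally_eq_zero ((τ : 𝒢.reducedAlgebra →L[ℂ] ℂ).toLinearMap ∘ₗ 𝒢.ofCcₗ) hS
    (fun a haS => ?_) f hf
  -- P separates r(a) from s(a). A function g supported on arrows from outside P into P satisfies g
  -- = 1_P g and g 1_P = 0, so the trace property gives τ(g) = τ(g 1_P) = 0.
  obtain ⟨P, hP, haP, hPs⟩ := compact_exists_isClopen_in_isOpen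
    (U := {𝒢.src a}ᶜ) isOpen_compl_singleton (hne a haS).symm
  refine ⟨𝒢.rng ⁻¹' P ∩ 𝒢.src ⁻¹' Pᶜ, (hP.preimage 𝒢.continuous_rng).inter
    (hP.compl.preimage 𝒢.continuous_src), ⟨haP, fun h => hPs h rfl⟩, fun g hg _ => ?_⟩
  have hg' : ∀ b, g b ≠ 0 → 𝒢.rng b ∈ P ∧ 𝒢.src b ∉ P := fun b hb => by
    by_contra h
    exact hb (hg b h)
  change τ (𝒢.ofCc g) = 0
  rw [← ofUnits_mul_ofCc_eq_self (φ := hP.charFn) (f := g)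
    fun b hb => hP.charFn_mem (hg' b hb).1, hτ.2.2,
    ofCc_mul_ofUnits_eq_zero fun b hb => hP.charFn_notMem (hg' b hb).2, map_zero]

/-- K is principal, so K without the units is a compact set of arrows whose range and source differ,
where the trace vanishes. What remains of f is its restriction to the units. -/
lemma map_ofCc_eq_map_expectation (ha : 𝒢.IsAmple) (hτ : τ ∈ tracialStates 𝒢.reducedAlgebra)
    {K : Set G} (hK : 𝒢.IsElementary K) {f : C_c(G, ℂ)} (hf : ∀ a ∉ K, f a = 0) :
    τ (𝒢.ofCc f) = τ (𝒢.ofUnits (𝒢.expectation (𝒢.ofCc f))) := by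
  have hU := 𝒢.isClopen_units
  have h0 : τ (𝒢.ofCc (hU.compl.charFn • f)) = 0 := by
    refine map_ofCc_eq_zero ha hτ (hK.isCompact.diff hU.2) (fun a ha h => ha.2
      (hK.principal a ha.1 h)) fun a ha => ?_
    by_cases haU : a ∈ range 𝒢.unit
    · simp [hU.compl.charFn_notMem (not_not.2 haU)]
    · simp [hf a fun h => ha ⟨h, haU⟩]
  have h1 : hU.charFn • f = 𝒢.extendUnits (𝒢.expectation (𝒢.ofCc f)) := by
    ext a
    by_cases haU : a ∈ range 𝒢.unit
    · obtain ⟨x, rfl⟩ := haU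
      simp [hU.charFn_mem (mem_range_self x), extendUnits_unit, expectation_ofCc]
    · simp [hU.charFn_notMem haU, extendUnits_notMem _ _ haU]
  rw [ofUnits, ← h1]
  conv_lhs => rw [← smul_charFn_add_compl hU f, ← ofCcₗ_apply, map_add, map_add, ofCcₗ_apply,
    ofCcₗ_apply, h0, add_zero]

/-- Functions supported in an elementary subgroupoid have the same trace after summation over
ranges and over sources. -/
lemma map_rngSum_eq_map_rngSum_flip (ha : 𝒢.IsAmple)
    (hτ : τ ∈ tracialStates 𝒢.reducedAlgebra) {K : Set G} (hK : 𝒢.IsElementary K)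
    {f : C_c(G, ℂ)} (hf : ∀ a ∉ K, f a = 0) :
    τ (𝒢.ofUnits (𝒢.rngSum f)) = τ (𝒢.ofUnits (𝒢.rngSum (𝒢.flip f))) := by
  -- Since K is closed under inversion, f · `flip` g = f, so the two fibre sums are E(f ⋆ g) and E(g
  -- ⋆ f). Both convolutions are again supported in K, where τ = τ ∘ E, and traciality equates them.
  set g := indicatorCc hK.isCompact hK.isOpen with hg
  have hinv : ∀ a, 𝒢.inv a ∈ K → a ∈ K := fun a h => by
    rw [← 𝒢.inv_inv a]; exact hK.inv_mem _ h
  have hfg : f * 𝒢.flip g = f := by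
    ext a
    by_cases h : a ∈ K
    · simp [hg, indicatorCc_mem hK.isCompact hK.isOpen (hK.inv_mem a h)]
    · simp [hf a h]
  have hg0 : ∀ a ∉ K, g a = 0 := fun a => indicatorCc_notMem hK.isCompact hK.isOpen
  have hconv : ∀ p q : C_c(G, ℂ), (∀ a ∉ K, p a = 0) → (∀ a ∉ K, q a = 0) →
      ∀ a ∉ K, 𝒢.conv p q a = 0 := by
    intro p q hp hq a haK
    refine finsum_mem_eq_zero_of_forall_eq_zero (s := {b | 𝒢.rng b = 𝒢.rng a}) fun b hb => ?_
    by_cases hbK : b ∈ K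
    · rw [hq, mul_zero]
      intro h
      refine haK ?_
      rw [← 𝒢.inv_mul_cancel_left b a hb]
      exact hK.mul_mem _ hbK _ h (by
        rw [𝒢.rng_mul _ _ (by rw [𝒢.src_inv]; exact hb), 𝒢.rng_inv])
    · rw [hp b hbK, zero_mul]
  have h1 := 𝒢.expectation_ofCc_mul_ofCc f g
  have h2 := 𝒢.expectation_ofCc_mul_ofCc_swap f g
  rw [hfg] at h1 h2
  rw [← h1, ← h2, ofCc_mul_ofCc, ofCc_mul_ofCc,
    ← map_ofCc_eq_map_expectation ha hτ hK (hconv _ _ hf hg0),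
    ← map_ofCc_eq_map_expectation ha hτ hK (hconv _ _ hg0 hf), ← ofCc_mul_ofCc,
    ← ofCc_mul_ofCc, hτ.2.2]

/-- 1_D may be replaced by its average over K-orbits. Give each k ∈ K the weight 1_D(r(k)) divided
by the size of its orbit: the range sums of the weights recover 1_D, while the source sum at x is
the proportion of K x with range in D. The two sums have equal trace, and the second is at most δ
everywhere. -/
lemma re_map_charFn_le (ha : 𝒢.IsAmple) (hτ : τ ∈ tracialStates 𝒢.reducedAlgebra) {K : Set G}
    (hK : 𝒢.IsElementary K) {D : Set X} (hD : IsClopen D) {δ : ℝ}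
    (hδ : ∀ x, ({k ∈ 𝒢.fiber K x | 𝒢.rng k ∈ D}.ncard : ℝ) ≤ δ * (𝒢.fiber K x).ncard) :
    (τ (𝒢.ofUnits hD.charFn)).re ≤ δ := by
  classical
  set χ := indicatorCc hK.isCompact hK.isOpen with hχ
  have hχ0 : ∀ a ∉ K, χ a = 0 := fun a => indicatorCc_notMem hK.isCompact hK.isOpen
  -- The bijection l ↦ k l⁻¹ counts the arrows of K with range r(k). Thus the normalising factor is
  -- the same at r(k) and at s(k), that is, constant along orbits.
  have hn : ∀ k ∈ K, 𝒢.rngSum χ (𝒢.rng k) = ((𝒢.fiber K (𝒢.src k)).ncard : ℂ) := by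
    intro k hk
    rw [hK.rngSum_apply hχ0 hk, ncard_eq_toFinset_card _ (𝒢.finite_fiber hK.isCompact (𝒢.src k)),
      Finset.sum_congr rfl (g := fun _ => (1 : ℂ)), Finset.sum_const, nsmul_one]
    intro l hl
    rw [Finite.mem_toFinset] at hl
    exact indicatorCc_mem hK.isCompact hK.isOpen
      (hK.mul_mem _ hk _ (hK.inv_mem _ hl.1) (by rw [𝒢.rng_inv, hl.2]))
  have hnx : ∀ x, 𝒢.rngSum χ x = ((𝒢.fiber K x).ncard : ℂ) := fun x => by
    simpa only [𝒢.rng_unit, 𝒢.src_unit] using hn _ (hK.unit_mem x)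
  have hn0 : ∀ x, 𝒢.rngSum χ x ≠ 0 := fun x => by
    rw [hnx]; exact_mod_cast (hK.fiber_ncard_pos x).ne'
  let ψ : C(X, ℂ) := ⟨fun x => hD.charFn x * (𝒢.rngSum χ x)⁻¹,
    hD.charFn.continuous.mul ((𝒢.rngSum χ).continuous.inv₀ hn0)⟩
  set f : C_c(G, ℂ) := (ψ.comp ⟨𝒢.rng, 𝒢.continuous_rng⟩) • χ with hf
  have hfa : ∀ a, f a = ψ (𝒢.rng a) * χ a := fun a => rfl
  have hf0 : ∀ a ∉ K, f a = 0 := fun a h => by rw [hfa, hχ0 a h, mul_zero]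
  have h1 : 𝒢.rngSum f = hD.charFn := by
    ext x
    have : 𝒢.rngSum f x = ψ x * 𝒢.rngSum χ x := by
      rw [rngSum_apply, rngSum_apply, ← smul_eq_mul, smul_finsum]
      refine finsum_congr fun a => ?_
      rw [smul_finsum]
      refine finsum_congr fun h => ?_
      rw [hfa, h, smul_eq_mul]
    rw [this]
    exact inv_mul_cancel_right₀ (hn0 x) _
  have h2 : ∀ x, 𝒢.rngSum (𝒢.flip f) x ≤ (δ : ℂ) := by
    intro x
    set F := (𝒢.finite_fiber hK.isCompact x).toFinset with hF
    have hFc : (𝒢.fiber K x).ncard = F.card := ncard_eq_toFinset_card _ _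
    have e1 : 𝒢.rngSum (𝒢.flip f) x =
        (((F.filter fun k => 𝒢.rng k ∈ D).card / F.card : ℝ) : ℂ) := by
      rw [hK.rngSum_flip_apply hf0, Finset.card_filter]
      push_cast
      rw [Finset.sum_div]
      refine Finset.sum_congr rfl fun k hk => ?_
      rw [Finite.mem_toFinset] at hk
      have e2 : χ k = 1 := indicatorCc_mem hK.isCompact hK.isOpen hk.1
      have e3 : ψ (𝒢.rng k) = hD.charFn (𝒢.rng k) * (𝒢.rngSum χ (𝒢.rng k))⁻¹ := rfl
      rw [hfa, e2, mul_one, e3, hn k hk.1, hk.2, hFc, div_eq_mul_inv]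
      congr 1
      split_ifs with h
      exacts [hD.charFn_mem h, hD.charFn_notMem h]
    rw [e1, Complex.real_le_real, div_le_iff₀, ← hFc]
    · refine le_trans (le_of_eq ?_) (hδ x)
      rw [← ncard_coe_finset]
      congr 2
      ext k
      simp [hF]
    · rw [← hFc]
      exact_mod_cast hK.fiber_ncard_pos x
  rw [← h1, map_rngSum_eq_map_rngSum_flip ha hτ hK hf0]
  exact re_map_ofUnits_le hτ h2

end EtaleGroupoid

/-! ### Estimates off the elementary subgroupoid and factorisation through the expectation -/

namespace EtaleGroupoid

variable {X G : Type*} [TopologicalSpace X] [TopologicalSpace G] {𝒢 : EtaleGroupoid X G}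

/-- Cutting down a function to a clopen set does not increase its band constants. -/
lemma isBandKernel_smul_charFn {f : C_c(G, ℂ)} {N : ℕ} {M : ℝ} (hM : 0 ≤ M)
    (h : IsBandKernel (𝒢.kernel f) N M) {U : Set G} (hU : IsClopen U) :
    IsBandKernel (𝒢.kernel (hU.charFn • f)) N M := by
  have key : ∀ a b, 𝒢.kernel (hU.charFn • f) a b = 0 ∨
      𝒢.kernel (hU.charFn • f) a b = 𝒢.kernel f a b := by
    intro a b
    by_cases hab : 𝒢.mul a (𝒢.inv b) ∈ U
    · right
      simp [kernel, hU.charFn_mem hab]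
    · left
      simp [kernel, hU.charFn_notMem hab]
  have key' : ∀ a b, 𝒢.kernel (hU.charFn • f) a b ≠ 0 → 𝒢.kernel f a b ≠ 0 := by
    intro a b hab
    rwa [← (key a b).resolve_left hab]
  refine ⟨fun a => (encard_le_encard fun b => key' a b).trans (h.row a),
    fun b => (encard_le_encard fun a => key' a b).trans (h.col b), fun a b => ?_⟩
  rcases key a b with h1 | h1
  · rw [h1, norm_zero]; exact hM
  · rw [h1]; exact h.bound a b

variable [T2Space G] [CompactSpace X] {τ : WeakDual ℂ 𝒢.reducedAlgebra}

lemma re_map_charFn_nonneg (hτ : τ ∈ tracialStates 𝒢.reducedAlgebra) {D : Set X}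
    (hD : IsClopen D) : 0 ≤ (τ (𝒢.ofUnits hD.charFn)).re := by
  refine (Complex.le_def.1 (map_ofUnits_nonneg hτ fun x => ?_)).1
  by_cases hx : x ∈ D
  · rw [hD.charFn_mem hx]; exact zero_le_one
  · rw [hD.charFn_notMem hx]

/-- Cauchy–Schwarz for a⋆ and the projection 1_D, with τ(aa⋆) bounded by ‖τ‖‖a‖². -/
lemma norm_map_mul_charFn_sq_le (hτ : τ ∈ tracialStates 𝒢.reducedAlgebra) {D : Set X}
    (hD : IsClopen D) (a : 𝒢.reducedAlgebra) :
    ‖τ (a * 𝒢.ofUnits hD.charFn)‖ ^ 2 ≤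
      ‖WeakDual.toStrongDual τ‖ * ‖a‖ ^ 2 * (τ (𝒢.ofUnits hD.charFn)).re := by
  have h := norm_map_star_mul_sq_le hτ.2.1 (star a) (𝒢.ofUnits hD.charFn)
  have e : star (𝒢.ofUnits hD.charFn) * 𝒢.ofUnits hD.charFn = 𝒢.ofUnits hD.charFn := by
    rw [star_ofUnits, ← ofUnits_mul]
    congr 1
    ext x
    by_cases hx : x ∈ D
    · simp [hD.charFn_mem hx]
    · simp [hD.charFn_notMem hx]
  rw [star_star, e] at h
  refine h.trans (mul_le_mul_of_nonneg_right ?_ ?_)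
  · refine (Complex.re_le_norm _).trans (((WeakDual.toStrongDual τ).le_opNorm _).trans ?_)
    refine mul_le_mul_of_nonneg_left ((norm_mul_le _ _).trans_eq ?_) (norm_nonneg _)
    rw [show ‖star a‖ = ‖a‖ from norm_star a.1, sq]
  · exact re_map_charFn_nonneg hτ hD

/-- The error is the trace of f cut down to the complement of K. It is supported on arrows with
source in D = s(C \ K), a set of trace at most Nε. The other constants do not depend on K, so the
right side vanishes as ε → 0. -/
lemma norm_map_ofCc_sub_sq_le (ha : 𝒢.IsAmple) (hτ : τ ∈ tracialStates 𝒢.reducedAlgebra)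
    {f : C_c(G, ℂ)} {C : Set G} (hC : IsCompact C) (hCo : IsOpen C) (hfC : tsupport f ⊆ C) {N : ℕ}
    (hN : ∀ x, {a ∈ C | 𝒢.rng a = x}.encard ≤ N) {N' : ℕ} {M : ℝ}
    (hband : IsBandKernel (𝒢.kernel f) N' M) (hM : 0 ≤ M) {K : Set G} (hK : 𝒢.IsElementary K)
    {ε : ℝ} (hKi : 𝒢.IsInvariantFor C ε K) :
    ‖τ (𝒢.ofCc f) - τ (𝒢.ofUnits (𝒢.expectation (𝒢.ofCc f)))‖ ^ 2 ≤
      ‖WeakDual.toStrongDual τ‖ * (N' * M) ^ 2 * (N * ε) := by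
  have := 𝒢.t2Space_units
  have hKc : IsClopen K := ⟨hK.isCompact.isClosed, hK.isOpen⟩
  have hD : IsClopen (𝒢.src '' (C \ K)) :=
    ⟨((hC.diff hK.isOpen).image 𝒢.continuous_src).isClosed,
      𝒢.isOpenMap_src _ (hCo.sdiff hKc.1)⟩
  have h1 : τ (𝒢.ofCc (hKc.charFn • f)) = τ (𝒢.ofUnits (𝒢.expectation (𝒢.ofCc f))) := by
    rw [map_ofCc_eq_map_expectation ha hτ hK]
    · congr 2
      ext x
      rw [expectation_ofCc, expectation_ofCc]
      simp [hKc.charFn_mem (hK.unit_mem x)]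
    · intro a haK
      simp [hKc.charFn_notMem haK]
  have h2 : τ (𝒢.ofCc f) - τ (𝒢.ofUnits (𝒢.expectation (𝒢.ofCc f))) =
      τ (𝒢.ofCc (hKc.compl.charFn • f)) := by
    have h := congrArg (fun g => τ (𝒢.ofCcₗ g)) (smul_charFn_add_compl hKc f)
    simp only [map_add, ofCcₗ_apply] at h
    rw [← h1, ← h, add_sub_cancel_left]
  have h3 : 𝒢.ofCc (hKc.compl.charFn • f) * 𝒢.ofUnits hD.charFn =
      𝒢.ofCc (hKc.compl.charFn • f) := by
    refine ofCc_mul_ofUnits_eq_self fun a haf => hD.charFn_mem ⟨a, ⟨?_, ?_⟩, rfl⟩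
    · by_contra h
      refine haf ?_
      simp [image_eq_zero_of_notMem_tsupport fun h' => h (hfC h')]
    · intro h
      refine haf ?_
      simp [hKc.compl.charFn_notMem (not_not.2 h)]
  -- Each k ∈ K x with range in D is the second entry of a composable pair (c, k) with c ∈ C \ K, so
  -- the count of such pairs bounds the proportion of the orbit inside D.
  have h4 : (τ (𝒢.ofUnits hD.charFn)).re ≤ N * ε := by
    refine re_map_charFn_le ha hτ hK hD fun x => ?_
    refine le_trans ?_ (𝒢.ncard_composablePairs_le hC hK hKi hN x)
    have hfin := 𝒢.finite_composablePairs (hC.diff hK.isOpen) hK.isCompact x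
    refine Nat.cast_le.2 ((ncard_le_ncard ?_ (hfin.image Prod.snd)).trans (ncard_image_le hfin))
    rintro k ⟨hk, c, hc, hck⟩
    exact ⟨(c, k), ⟨hc, hk, hck⟩, rfl⟩
  have h5 := norm_map_mul_charFn_sq_le hτ hD (𝒢.ofCc (hKc.compl.charFn • f))
  rw [h3] at h5
  rw [h2]
  have h6 := 𝒢.norm_ofCc_le (isBandKernel_smul_charFn hM hband hKc.compl) hM
  refine h5.trans (mul_le_mul ?_ h4 (re_map_charFn_nonneg hτ hD) (by positivity))
  exact mul_le_mul_of_nonneg_left (pow_le_pow_left₀ (norm_nonneg _) h6 2) (by positivity)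

variable [LocallyCompactSpace G]

lemma map_ofCc_eq (h𝒢 : 𝒢.IsAlmostFinite) (hτ : τ ∈ tracialStates 𝒢.reducedAlgebra)
    (f : C_c(G, ℂ)) : τ (𝒢.ofCc f) = τ (𝒢.ofUnits (𝒢.expectation (𝒢.ofCc f))) := by
  obtain ⟨ha, happ⟩ := h𝒢
  obtain ⟨C, hC, hCo, hfC, -⟩ := 𝒢.exists_compact_open_superset ha
    f.hasCompactSupport.isCompact isOpen_univ (subset_univ _)
  obtain ⟨N, hN⟩ := 𝒢.exists_rng_fiber_bound hC
  obtain ⟨N', M, hband, hM⟩ := 𝒢.exists_isBandKernel f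
  have key : ∀ ε : ℝ, 0 < ε → _ := fun ε hε =>
    let ⟨_, hK, hKi⟩ := happ C hC ε hε
    norm_map_ofCc_sub_sq_le ha hτ hC hCo hfC hN hband hM hK hKi
  rw [← sub_eq_zero, ← norm_eq_zero]
  generalize ‖τ (𝒢.ofCc f) - τ (𝒢.ofUnits (𝒢.expectation (𝒢.ofCc f)))‖ = d at key ⊢
  have hB0 : 0 ≤ ‖WeakDual.toStrongDual τ‖ * (N' * M) ^ 2 * N := by positivity
  generalize ‖WeakDual.toStrongDual τ‖ * (N' * M) ^ 2 = B at key hB0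
  by_contra hne
  have hpos : 0 < d ^ 2 := by positivity
  -- With this ε the bound reads 2(BN + 1)d² ≤ BN d², impossible for d ≠ 0. The added 1 keeps the
  -- denominator positive when BN = 0.
  have h1 := key (d ^ 2 / (2 * (B * N + 1))) (by positivity)
  rw [← mul_assoc, ← mul_div_assoc, le_div_iff₀ (by positivity)] at h1
  nlinarith

theorem map_eq_map_expectation (h𝒢 : 𝒢.IsAlmostFinite)
    (hτ : τ ∈ tracialStates 𝒢.reducedAlgebra) (a : 𝒢.reducedAlgebra) :
    τ a = τ (𝒢.ofUnits (𝒢.expectation a)) := by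
  have h : IsClosed {a | τ a = τ (𝒢.ofUnits (𝒢.expectation a))} :=
    isClosed_eq (WeakDual.toStrongDual τ).continuous ((WeakDual.toStrongDual τ).continuous.comp
      (𝒢.continuous_ofUnits.comp 𝒢.expectation.continuous))
  exact 𝒢.denseRange_ofCc.induction_on (p := fun a => τ a = τ (𝒢.ofUnits (𝒢.expectation a)))
    a h (map_ofCc_eq h𝒢 hτ)

end EtaleGroupoid

/-! ### Integration of continuous functions on the unit space -/

lemma ContinuousMap.integrable_of_compactSpace {X E : Type*} [TopologicalSpace X] [CompactSpace X]
    [MeasurableSpace X] [BorelSpace X] [NormedAddCommGroup E] (μ : Measure X) [IsFiniteMeasure μ]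
    (φ : C(X, E)) : Integrable φ μ :=
  φ.continuous.integrable_of_hasCompactSupport (HasCompactSupport.of_compactSpace _)

/-- Integration against a finite measure, as a functional on `C(X, ℂ)`. -/
def ContinuousMap.integralFunctional {X : Type*} [TopologicalSpace X] [CompactSpace X]
    [MeasurableSpace X] [BorelSpace X] (μ : Measure X) [IsFiniteMeasure μ] : C(X, ℂ) →L[ℂ] ℂ :=
  LinearMap.mkContinuous
    { toFun := fun φ => ∫ x, φ x ∂μ
      map_add' := fun φ ψ =>
        integral_add (φ.integrable_of_compactSpace μ) (ψ.integrable_of_compactSpace μ)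
      map_smul' := fun c φ => integral_const_mul c φ } (μ.real univ) fun φ => by
    rw [mul_comm]
    exact norm_integral_le_of_norm_le_const (Eventually.of_forall fun x => φ.norm_coe_le_norm x)

lemma ContinuousMap.integralFunctional_apply {X : Type*} [TopologicalSpace X] [CompactSpace X]
    [MeasurableSpace X] [BorelSpace X] (μ : Measure X) [IsFiniteMeasure μ] (φ : C(X, ℂ)) :
    ContinuousMap.integralFunctional μ φ = ∫ x, φ x ∂μ := rfl

lemma IsClopen.integral_charFn {X : Type*} [TopologicalSpace X] [MeasurableSpace X] [BorelSpace X]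
    (μ : Measure X) {D : Set X} (hD : IsClopen D) :
    ∫ x, hD.charFn x ∂μ = (μ.real D : ℂ) := by
  refine (integral_indicator_const (1 : ℂ) hD.2.measurableSet).trans ?_
  simp

lemma MeasurableEmbedding.integral_comap_eq {V X : Type*} [MeasurableSpace V] [MeasurableSpace X] {p : V → X}
    (hp : MeasurableEmbedding p) (μ : Measure X) {φ : X → ℂ} (hφ : ∀ x ∉ range p, φ x = 0) :
    ∫ x, φ x ∂μ = ∫ v, φ (p v) ∂(μ.comap p) := by
  rw [← setIntegral_eq_integral_of_forall_compl_eq_zero hφ, ← hp.map_comap, hp.integral_map]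

/-! ### Fibre sums and invariance of measures -/

namespace EtaleGroupoid

variable {X G : Type*} [TopologicalSpace X] [TopologicalSpace G] (𝒢 : EtaleGroupoid X G)

lemma rngSum_apply_of_injOn [T2Space G] {f : C_c(G, ℂ)} {V : Set G} (hV : InjOn 𝒢.rng V)
    (hf : ∀ a ∉ V, f a = 0) {a : G} (ha : a ∈ V) : 𝒢.rngSum f (𝒢.rng a) = f a := by
  refine finsum_cond_eq_apply (p := fun b => 𝒢.rng b = 𝒢.rng a) rfl fun b hb hne => hf b fun h => ?_
  exact hne (hV h ha hb)

lemma rngSum_apply_of_notMem [T2Space G] {f : C_c(G, ℂ)} {V : Set G}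
    (hf : ∀ a ∉ V, f a = 0) {x : X} (hx : x ∉ 𝒢.rng '' V) : 𝒢.rngSum f x = 0 := by
  refine finsum_mem_eq_zero_of_forall_eq_zero (s := {a | 𝒢.rng a = x}) fun a ha => hf a fun h => ?_
  exact hx ⟨a, h, ha⟩

lemma rngSum_flip_apply_of_injOn [T2Space G] {f : C_c(G, ℂ)} {V : Set G} (hV : InjOn 𝒢.src V)
    (hf : ∀ a ∉ V, f a = 0) {a : G} (ha : a ∈ V) : 𝒢.rngSum (𝒢.flip f) (𝒢.src a) = f a := by
  rw [rngSum_flip_apply]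
  refine finsum_cond_eq_apply (p := fun b => 𝒢.src b = 𝒢.src a) rfl fun b hb hne => hf b fun h => ?_
  exact hne (hV h ha hb)

lemma rngSum_flip_apply_of_notMem [T2Space G] {f : C_c(G, ℂ)} {V : Set G}
    (hf : ∀ a ∉ V, f a = 0) {x : X} (hx : x ∉ 𝒢.src '' V) : 𝒢.rngSum (𝒢.flip f) x = 0 := by
  rw [rngSum_flip_apply]
  refine finsum_mem_eq_zero_of_forall_eq_zero (s := {a | 𝒢.src a = x}) fun a ha => hf a fun h => ?_
  exact hx ⟨a, h, ha⟩

section Measure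

variable [MeasurableSpace X]

/-- Inner regularity reduces an inequality for open sets to compact open sets. -/
lemma measure_image_le_of_compact_open [T2Space G] [LocallyCompactSpace G] (ha : 𝒢.IsAmple)
    (μ : Measure X) [μ.Regular] {p q : G → X} (hp : IsOpenMap p) {V : Set G} (hV : IsOpen V)
    (hpV : IsEmbedding (V.domRestrict p))
    (h : ∀ W ⊆ V, IsCompact W → IsOpen W → μ (p '' W) = μ (q '' W)) :
    μ (p '' V) ≤ μ (q '' V) := by
  rw [(hp V hV).measure_eq_iSup_isCompact]
  refine iSup_le fun S => iSup_le fun hSV => iSup_le fun hS => ?_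
  have hSe : V.domRestrict p '' (V.domRestrict p ⁻¹' S) = S :=
    image_preimage_eq_of_subset (by rwa [range_domRestrict])
  -- A compact subset S of p(V) lifts to a compact subset of V because p embeds V. The lift is then
  -- enlarged to a compact open set inside V, where the hypothesis applies.
  have hT : IsCompact (Subtype.val '' (V.domRestrict p ⁻¹' S)) :=
    (hpV.isCompact_iff.2 (by rwa [hSe])).image continuous_subtype_val
  obtain ⟨W, hW, hWo, hTW, hWV⟩ :=
    𝒢.exists_compact_open_superset ha hT hV (image_subset_iff.2 fun v _ => v.2)
  calc μ S = μ (p '' (Subtype.val '' (V.domRestrict p ⁻¹' S))) := by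
        rw [image_image]; exact congrArg μ hSe.symm
    _ ≤ μ (p '' W) := measure_mono (image_mono hTW)
    _ = μ (q '' W) := h W hWV hW hWo
    _ ≤ μ (q '' V) := measure_mono (image_mono hWV)

variable [BorelSpace X]

/-- An invariant measure gives the same mass to both fibre sums of a function on `G`. -/
lemma integral_rngSum_flip [T2Space G] [LocallyCompactSpace G] [CompactSpace X] (ha : 𝒢.IsAmple)
    (μ : Measure X) [IsFiniteMeasure μ]
    (hμ : ∀ V, IsOpen V → 𝒢.IsBisection V → μ (𝒢.src '' V) = μ (𝒢.rng '' V)) (f : C_c(G, ℂ)) :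
    ∫ x, 𝒢.rngSum f x ∂μ = ∫ x, 𝒢.rngSum (𝒢.flip f) x ∂μ := by
  rw [← sub_eq_zero]
  refine eq_zero_of_locally_eq_zero
    ((ContinuousMap.integralFunctional μ).toLinearMap ∘ₗ 𝒢.rngSum -
      (ContinuousMap.integralFunctional μ).toLinearMap ∘ₗ 𝒢.rngSum ∘ₗ 𝒢.flip)
    f.hasCompactSupport.isCompact (fun a _ => ?_) f fun b => image_eq_zero_of_notMem_tsupport
  obtain ⟨V, hVc, hVo, haV, hV⟩ := 𝒢.exists_compact_open_bisection ha a
  refine ⟨V, ⟨hVc.isClosed, hVo⟩, haV, fun g hg _ => ?_⟩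
  change (∫ x, 𝒢.rngSum g x ∂μ) - ∫ x, 𝒢.rngSum (𝒢.flip g) x ∂μ = 0
  let _ : MeasurableSpace V := borel V
  have : BorelSpace V := ⟨rfl⟩
  have hr : MeasurableEmbedding (V.domRestrict 𝒢.rng) :=
    (IsOpenEmbedding.mk hV.2 (by
      rw [range_domRestrict]; exact 𝒢.isOpenMap_rng V hVo)).measurableEmbedding
  have hs : MeasurableEmbedding (V.domRestrict 𝒢.src) :=
    (IsOpenEmbedding.mk hV.1 (by
      rw [range_domRestrict]; exact 𝒢.isOpenMap_src V hVo)).measurableEmbedding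
  have himg : ∀ (p : G → X) (U : Set V), V.domRestrict p '' U = p '' (Subtype.val '' U) :=
    fun p U => (image_image p Subtype.val U).symm
  -- For g supported in the bisection V, both fibre sums are g transported along r or s. It suffices
  -- that μ pulls back to the same measure on V along both maps; invariance gives this on open sets,
  -- which form a generating π-system.
  have hopen : ∀ U : Set V, IsOpen U →
      μ.comap (V.domRestrict 𝒢.rng) U = μ.comap (V.domRestrict 𝒢.src) U := by
    intro U hU
    have hU' : IsOpen (Subtype.val '' U) := hVo.isOpenMap_subtype_val U hU
    have hUV : Subtype.val '' U ⊆ V := image_subset_iff.2 fun v _ => v.2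
    rw [hr.comap_apply, hs.comap_apply, himg, himg]
    exact (hμ _ hU' (𝒢.isBisection_of_injOn hU' (hV.injOn_src.mono hUV)
      (hV.injOn_rng.mono hUV))).symm
  have heq : μ.comap (V.domRestrict 𝒢.rng) = μ.comap (V.domRestrict 𝒢.src) :=
    ext_of_generate_finite _ BorelSpace.measurable_eq
      isPiSystem_isOpen (fun U hU => hopen U hU) (hopen univ isOpen_univ)
  rw [hr.integral_comap_eq μ (φ := 𝒢.rngSum g), hs.integral_comap_eq μ (φ := 𝒢.rngSum (𝒢.flip g)),
    heq, sub_eq_zero]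
  · congr 1
    ext v
    exact (𝒢.rngSum_apply_of_injOn hV.injOn_rng hg v.2).trans
      (𝒢.rngSum_flip_apply_of_injOn hV.injOn_src hg v.2).symm
  · intro x hx
    rw [range_domRestrict] at hx
    exact 𝒢.rngSum_flip_apply_of_notMem hg hx
  · intro x hx
    rw [range_domRestrict] at hx
    exact 𝒢.rngSum_apply_of_notMem hg hx

/-- A regular measure with equal integrals of fibre sums is invariant. -/
lemma measure_src_eq_measure_rng [T2Space G] [LocallyCompactSpace G] [CompactSpace X]
    (ha : 𝒢.IsAmple) (μ : Measure X) [IsFiniteMeasure μ] [μ.Regular]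
    (hμ : ∀ f : C_c(G, ℂ), ∫ x, 𝒢.rngSum f x ∂μ = ∫ x, 𝒢.rngSum (𝒢.flip f) x ∂μ)
    {V : Set G} (hV : IsOpen V) (hVb : 𝒢.IsBisection V) : μ (𝒢.src '' V) = μ (𝒢.rng '' V) := by
  have := 𝒢.t2Space_units
  -- On a bisection r and s are injective, so the fibre sums of the indicator of W are the
  -- indicators of r(W) and s(W).
  have key : ∀ W ⊆ V, IsCompact W → IsOpen W → μ (𝒢.src '' W) = μ (𝒢.rng '' W) := by
    intro W hWV hW hWo
    have hr : IsClopen (𝒢.rng '' W) :=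
      ⟨(hW.image 𝒢.continuous_rng).isClosed, 𝒢.isOpenMap_rng W hWo⟩
    have hs : IsClopen (𝒢.src '' W) :=
      ⟨(hW.image 𝒢.continuous_src).isClosed, 𝒢.isOpenMap_src W hWo⟩
    have h0 : ∀ a ∉ W, indicatorCc hW hWo a = 0 := fun a => indicatorCc_notMem hW hWo
    have e1 : 𝒢.rngSum (indicatorCc hW hWo) = hr.charFn := by
      ext x
      by_cases hx : x ∈ 𝒢.rng '' W
      · rw [hr.charFn_mem hx]
        obtain ⟨a, ha, rfl⟩ := hx
        rw [𝒢.rngSum_apply_of_injOn (hVb.injOn_rng.mono hWV) h0 ha, indicatorCc_mem hW hWo ha]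
      · rw [hr.charFn_notMem hx, 𝒢.rngSum_apply_of_notMem h0 hx]
    have e2 : 𝒢.rngSum (𝒢.flip (indicatorCc hW hWo)) = hs.charFn := by
      ext x
      by_cases hx : x ∈ 𝒢.src '' W
      · rw [hs.charFn_mem hx]
        obtain ⟨a, ha, rfl⟩ := hx
        rw [𝒢.rngSum_flip_apply_of_injOn (hVb.injOn_src.mono hWV) h0 ha, indicatorCc_mem hW hWo ha]
      · rw [hs.charFn_notMem hx, 𝒢.rngSum_flip_apply_of_notMem h0 hx]
    have h := hμ (indicatorCc hW hWo)
    rw [e1, e2, hr.integral_charFn, hs.integral_charFn, Complex.ofReal_inj,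
      measureReal_eq_measureReal_iff] at h
    exact h.symm
  exact le_antisymm
    (𝒢.measure_image_le_of_compact_open ha μ 𝒢.isOpenMap_src hV hVb.1 key)
    (𝒢.measure_image_le_of_compact_open ha μ 𝒢.isOpenMap_rng hV hVb.2
      fun W h1 h2 h3 => (key W h1 h2 h3).symm)

end Measure

variable [T2Space G] [CompactSpace X]

/-- An invariant state on `C(G⁽⁰⁾)` composed with the expectation is a tracial state. -/
lemma comp_expectation_mem_tracialStates (L : C(X, ℂ) →L[ℂ] ℂ) (h1 : L 1 = 1)
    (hpos : ∀ φ : C(X, ℂ), (∀ x, 0 ≤ φ x) → 0 ≤ L φ)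
    (hinv : ∀ f, L (𝒢.rngSum f) = L (𝒢.rngSum (𝒢.flip f))) :
    StrongDual.toWeakDual (L ∘L 𝒢.expectation) ∈ tracialStates 𝒢.reducedAlgebra := by
  refine ⟨?_, fun a => hpos _ fun x => ?_, fun a b => ?_⟩
  · change L (𝒢.expectation 1) = 1
    rw [expectation_one, h1]
  · obtain ⟨r, hr, h⟩ := 𝒢.expectation_star_mul_self a x
    change 0 ≤ 𝒢.expectation (star a * a) x
    rw [h]
    exact Complex.zero_le_real.2 hr
  · change L (𝒢.expectation (a * b)) = L (𝒢.expectation (b * a))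
    -- The trace identity is closed in the pair (a, b), so it need only be checked on C_c(G), where
    -- it is the invariance of L.
    have hcl : IsClosed {p : 𝒢.reducedAlgebra × 𝒢.reducedAlgebra |
        L (𝒢.expectation (p.1 * p.2)) = L (𝒢.expectation (p.2 * p.1))} :=
      isClosed_eq (by fun_prop) (by fun_prop)
    refine (𝒢.denseRange_ofCc.prodMap 𝒢.denseRange_ofCc).induction_on
      (p := fun p => L (𝒢.expectation (p.1 * p.2)) = L (𝒢.expectation (p.2 * p.1)))
      (a, b) hcl fun p => ?_
    change L (𝒢.expectation (𝒢.ofCc p.1 * 𝒢.ofCc p.2)) =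
      L (𝒢.expectation (𝒢.ofCc p.2 * 𝒢.ofCc p.1))
    rw [expectation_ofCc_mul_ofCc, expectation_ofCc_mul_ofCc_swap, hinv]

variable {𝒢} {τ : WeakDual ℂ 𝒢.reducedAlgebra}

/-- A function f equals f · 1_C for a compact open C containing its support, so its two fibre sums
are expectations of the products of f with `flip` 1_C in both orders. Since τ = τ ∘ E is now known
on the whole algebra, no subgroupoid is needed. -/
lemma map_rngSum_eq [LocallyCompactSpace G] (h𝒢 : 𝒢.IsAlmostFinite)
    (hτ : τ ∈ tracialStates 𝒢.reducedAlgebra) (f : C_c(G, ℂ)) :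
    τ (𝒢.ofUnits (𝒢.rngSum f)) = τ (𝒢.ofUnits (𝒢.rngSum (𝒢.flip f))) := by
  obtain ⟨C, hC, hCo, hfC, -⟩ := 𝒢.exists_compact_open_superset h𝒢.1
    f.hasCompactSupport.isCompact isOpen_univ (subset_univ _)
  have hfg : f * 𝒢.flip (𝒢.flip (indicatorCc hC hCo)) = f := by
    ext a
    rw [flip_flip]
    by_cases h : a ∈ C
    · simp [indicatorCc_mem hC hCo h]
    · simp [image_eq_zero_of_notMem_tsupport fun h' => h (hfC h')]
  have h1 := 𝒢.expectation_ofCc_mul_ofCc f (𝒢.flip (indicatorCc hC hCo))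
  have h2 := 𝒢.expectation_ofCc_mul_ofCc_swap f (𝒢.flip (indicatorCc hC hCo))
  rw [hfg] at h1 h2
  rw [← h1, ← h2, ← map_eq_map_expectation h𝒢 hτ, ← map_eq_map_expectation h𝒢 hτ, hτ.2.2]

end EtaleGroupoid

/-! ### Convex combinations, extreme points and the homeomorphism -/

/-- An affine bijection preserves extreme points. -/
lemma mem_extremePoints_iff_of_affine {E F : Type*} [AddCommGroup E] [Module ℝ E]
    [AddCommMonoid F] [Module NNReal F] {A : Set E} {B : Set F} (Φ : A ≃ B)
    (hΦ : ∀ (τ σ : A) (s t : NNReal), s + t = 1 →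
      ∃ h : (s : ℝ) • (τ : E) + (t : ℝ) • (σ : E) ∈ A,
        (Φ ⟨_, h⟩ : F) = s • (Φ τ : F) + t • (Φ σ : F)) (τ : A) :
    (τ : E) ∈ extremePoints ℝ A ↔ (Φ τ : F) ∈ extremePoints NNReal B := by
  rw [mem_extremePoints_iff_left, mem_extremePoints_iff_left]
  refine ⟨fun h => ⟨(Φ τ).2, ?_⟩, fun h => ⟨τ.2, ?_⟩⟩
  · rintro μ hμ ν hν ⟨s, t, hs, ht, hst, he⟩
    obtain ⟨τ₁, h₁⟩ := Φ.surjective ⟨μ, hμ⟩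
    obtain ⟨τ₂, h₂⟩ := Φ.surjective ⟨ν, hν⟩
    obtain ⟨hm, h3⟩ := hΦ τ₁ τ₂ s t hst
    rw [h₁, h₂, he] at h3
    have h4 := congrArg Subtype.val (Φ.injective (Subtype.ext h3))
    have h5 := h.2 τ₁ τ₁.2 τ₂ τ₂.2 ⟨s, t, by exact_mod_cast hs, by exact_mod_cast ht,
      by exact_mod_cast hst, h4⟩
    rw [← Subtype.ext h5, h₁]
  · rintro τ₁ hτ₁ τ₂ hτ₂ ⟨s, t, hs, ht, hst, he⟩
    lift s to NNReal using hs.le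
    lift t to NNReal using ht.le
    have hst' : s + t = 1 := by exact_mod_cast hst
    obtain ⟨hm, h3⟩ := hΦ ⟨τ₁, hτ₁⟩ ⟨τ₂, hτ₂⟩ s t hst'
    have h4 : (⟨_, hm⟩ : A) = τ := Subtype.ext he
    rw [h4] at h3
    have h5 := h.2 _ (Φ ⟨τ₁, hτ₁⟩).2 _ (Φ ⟨τ₂, hτ₂⟩).2
      ⟨s, t, by exact_mod_cast hs, by exact_mod_cast ht, hst', h3.symm⟩
    exact congrArg Subtype.val (Φ.injective (Subtype.ext h5))

namespace EtaleGroupoid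

variable {X G : Type*} [TopologicalSpace X] [TopologicalSpace G] {𝒢 : EtaleGroupoid X G}

section Convex

variable [MeasurableSpace X] [BorelSpace X]

lemma add_smul_mem_invariantMeasures [T2Space G] {μ ν : FiniteMeasure X}
    (hμ : μ ∈ 𝒢.invariantMeasures) (hν : ν ∈ 𝒢.invariantMeasures) {s t : NNReal}
    (hst : s + t = 1) : s • μ + t • ν ∈ 𝒢.invariantMeasures := by
  have := 𝒢.t2Space_units
  obtain ⟨h1, h2, h3⟩ := hμ
  obtain ⟨k1, k2, k3⟩ := hν
  have e : ((s • μ + t • ν : FiniteMeasure X) : Measure X) = s • (μ : Measure X) + t • (ν : Measure X) :=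
    rfl
  refine ⟨⟨?_⟩, ?_, fun V hV hVb => ?_⟩
  · rw [e]
    simp only [Measure.coe_add, Pi.add_apply, Measure.coe_nnreal_smul_apply, measure_univ, mul_one]
    exact_mod_cast hst
  · rw [e]
    -- Regularity of the sum passes through inner regularity by compact sets, which is stable under
    -- scaling and addition and yields regularity for finite measures.
    have : Measure.InnerRegular (s • (μ : Measure X)) := inferInstance
    have : Measure.InnerRegular (t • (ν : Measure X)) := inferInstance
    have : Measure.InnerRegularCompactLTTop (s • (μ : Measure X) + t • (ν : Measure X)) :=
      inferInstance
    infer_instance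
  · rw [e]
    simp only [Measure.coe_add, Pi.add_apply, Measure.coe_nnreal_smul_apply, h3 V hV hVb,
      k3 V hV hVb]

lemma continuous_integral_real (f : BoundedContinuousFunction X ℝ) :
    Continuous fun μ : FiniteMeasure X => ∫ x, f x ∂(μ : Measure X) :=
  continuous_iff_continuousAt.2 fun _ =>
    FiniteMeasure.tendsto_iff_forall_integral_tendsto.1 tendsto_id f

variable [CompactSpace X]

lemma integral_add_smul (μ ν : FiniteMeasure X) (s t : NNReal) (φ : C(X, ℂ)) :
    ∫ x, φ x ∂((s • μ + t • ν : FiniteMeasure X) : Measure X) =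
      ((s : ℝ) : ℂ) * ∫ x, φ x ∂(μ : Measure X) + ((t : ℝ) : ℂ) * ∫ x, φ x ∂(ν : Measure X) := by
  rw [FiniteMeasure.toMeasure_add, integral_add_measure (φ.integrable_of_compactSpace _)
    (φ.integrable_of_compactSpace _), FiniteMeasure.toMeasure_smul, FiniteMeasure.toMeasure_smul,
    integral_smul_nnreal_measure, integral_smul_nnreal_measure]
  rfl

lemma continuous_integral_complex (φ : C(X, ℂ)) :
    Continuous fun μ : FiniteMeasure X => ∫ x, φ x ∂(μ : Measure X) := by
  have h : (fun μ : FiniteMeasure X => ∫ x, φ x ∂(μ : Measure X)) = fun μ : FiniteMeasure X =>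
      ((∫ x, (φ x).re ∂(μ : Measure X) : ℝ) : ℂ) +
        ((∫ x, (φ x).im ∂(μ : Measure X) : ℝ) : ℂ) * Complex.I :=
    funext fun μ => (integral_re_add_im (φ.integrable_of_compactSpace (μ : Measure X))).symm
  rw [h]
  have h1 := continuous_integral_real
    (BoundedContinuousFunction.mkOfCompact (⟨fun x => (φ x).re, by fun_prop⟩ : C(X, ℝ)))
  have h2 := continuous_integral_real
    (BoundedContinuousFunction.mkOfCompact (⟨fun x => (φ x).im, by fun_prop⟩ : C(X, ℝ)))
  exact (Complex.continuous_ofReal.comp h1).add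
    ((Complex.continuous_ofReal.comp h2).mul continuous_const)

end Convex

variable [T2Space G] [CompactSpace X]

lemma add_smul_apply {A : Type*} [NormedRing A] [NormedAlgebra ℂ A] (τ σ : WeakDual ℂ A)
    (s t : ℝ) (a : A) : (s • τ + t • σ) a = (s : ℂ) * τ a + (t : ℂ) * σ a := by
  change s • τ a + t • σ a = _
  rw [Complex.real_smul, Complex.real_smul]

lemma add_smul_mem_tracialStates {τ σ : WeakDual ℂ 𝒢.reducedAlgebra}
    (hτ : τ ∈ tracialStates 𝒢.reducedAlgebra) (hσ : σ ∈ tracialStates 𝒢.reducedAlgebra) {s t : ℝ}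
    (hs : 0 ≤ s) (ht : 0 ≤ t) (hst : s + t = 1) :
    s • τ + t • σ ∈ tracialStates 𝒢.reducedAlgebra := by
  have e := add_smul_apply τ σ s t
  refine ⟨?_, fun a => ?_, fun a b => ?_⟩
  · rw [e, hτ.1, hσ.1, mul_one, mul_one]
    exact_mod_cast hst
  · rw [e]
    exact add_nonneg (mul_nonneg (Complex.zero_le_real.2 hs) (hτ.2.1 a))
      (mul_nonneg (Complex.zero_le_real.2 ht) (hσ.2.1 a))
  · rw [e, e, hτ.2.2, hσ.2.2]

variable [MeasurableSpace X] [BorelSpace X]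

/-- The tracial state given by an invariant measure. -/
def traceOfMeasure (𝒢 : EtaleGroupoid X G) (μ : FiniteMeasure X) : WeakDual ℂ 𝒢.reducedAlgebra :=
  StrongDual.toWeakDual (ContinuousMap.integralFunctional (μ : Measure X) ∘L 𝒢.expectation)

lemma traceOfMeasure_apply (μ : FiniteMeasure X) (a : 𝒢.reducedAlgebra) :
    𝒢.traceOfMeasure μ a = ∫ x, 𝒢.expectation a x ∂(μ : Measure X) := rfl

lemma traceOfMeasure_mem [LocallyCompactSpace G] (ha : 𝒢.IsAmple) {μ : FiniteMeasure X}
    (hμ : μ ∈ 𝒢.invariantMeasures) :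
    𝒢.traceOfMeasure μ ∈ tracialStates 𝒢.reducedAlgebra := by
  have := hμ.1
  refine 𝒢.comp_expectation_mem_tracialStates _ ?_ (fun φ hφ => ?_)
    fun f => 𝒢.integral_rngSum_flip ha _ hμ.2.2 f
  · rw [ContinuousMap.integralFunctional_apply]
    simp
  · rw [ContinuousMap.integralFunctional_apply]
    have h : ∀ x, φ x = ((φ x).re : ℂ) := fun x =>
      Complex.ext rfl (Complex.le_def.1 (hφ x)).2.symm
    rw [integral_congr_ae (Eventually.of_forall h), integral_complex_ofReal]
    exact Complex.zero_le_real.2 (integral_nonneg fun x => (Complex.le_def.1 (hφ x)).1)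

/-- An invariant measure is determined by the integrals of complex continuous functions. -/
lemma eq_of_integral_eq {μ ν : FiniteMeasure X} (hμ : μ ∈ 𝒢.invariantMeasures)
    (hν : ν ∈ 𝒢.invariantMeasures)
    (h : ∀ φ : C(X, ℂ), ∫ x, φ x ∂(μ : Measure X) = ∫ x, φ x ∂(ν : Measure X)) : μ = ν := by
  have := 𝒢.t2Space_units
  have := hμ.2.1
  have := hν.2.1
  refine FiniteMeasure.toMeasure_injective
    (Measure.ext_of_integral_eq_on_compactlySupported fun f => ?_)
  have h1 := h ⟨fun x => (f x : ℂ), by fun_prop⟩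
  simp only [ContinuousMap.coe_mk, integral_complex_ofReal] at h1
  exact_mod_cast h1

/-- Riesz–Markov for the real part of τ on real functions. The imaginary part vanishes there because
τ is hermitian, and complex functions split into real and imaginary parts. Invariance comes from
`map_rngSum_eq`. -/
lemma exists_measure_of_trace [LocallyCompactSpace G] (h𝒢 : 𝒢.IsAlmostFinite)
    {τ : WeakDual ℂ 𝒢.reducedAlgebra} (hτ : τ ∈ tracialStates 𝒢.reducedAlgebra) :
    ∃ μ ∈ 𝒢.invariantMeasures, ∀ φ : C(X, ℂ), τ (𝒢.ofUnits φ) = ∫ x, φ x ∂(μ : Measure X) := by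
  have := 𝒢.t2Space_units
  let ι : C_c(X, ℝ) → C(X, ℂ) := fun f => ⟨fun x => (f x : ℂ), by fun_prop⟩
  have hadd : ∀ f g, ι (f + g) = ι f + ι g := fun f g => by ext x; simp [ι]
  have hsmul : ∀ (c : ℝ) f, ι (c • f) = (c : ℂ) • ι f := fun c f => by ext x; simp [ι]
  have hpos : ∀ f, 0 ≤ f → 0 ≤ τ (𝒢.ofUnits (ι f)) := fun f hf =>
    map_ofUnits_nonneg hτ fun x => Complex.zero_le_real.2 (hf x)
  let Λ : C_c(X, ℝ) →ₚ[ℝ] ℝ := PositiveLinearMap.mk₀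
    { toFun := fun f => (τ (𝒢.ofUnits (ι f))).re
      map_add' := fun f g => by
        rw [hadd, ← ofUnitsₗ_apply, map_add, map_add, Complex.add_re]; rfl
      map_smul' := fun c f => by
        rw [hsmul, ← ofUnitsₗ_apply, map_smul, map_smul, smul_eq_mul, Complex.re_ofReal_mul]; rfl }
    fun f hf => (Complex.le_def.1 (hpos f hf)).1
  have hreg : (RealRMK.rieszMeasure Λ).Regular := RealRMK.regular_rieszMeasure Λ
  have hfin : IsFiniteMeasure (RealRMK.rieszMeasure Λ) := inferInstance
  have hreal : ∀ f : C_c(X, ℝ), (τ (𝒢.ofUnits (ι f))).im = 0 := by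
    intro f
    have h := map_star_eq_conj hτ.2.1 (𝒢.ofUnits (ι f))
    rw [star_ofUnits, show star (ι f) = ι f by ext x; simp [ι]] at h
    exact Complex.conj_eq_iff_im.1 h.symm
  have hint : ∀ f : C_c(X, ℝ),
      τ (𝒢.ofUnits (ι f)) = ((∫ x, f x ∂(RealRMK.rieszMeasure Λ) : ℝ) : ℂ) := by
    intro f
    rw [RealRMK.integral_rieszMeasure]
    exact Complex.ext rfl (hreal f)
  have hall : ∀ φ : C(X, ℂ), τ (𝒢.ofUnits φ) = ∫ x, φ x ∂(RealRMK.rieszMeasure Λ) := by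
    intro φ
    let u : C_c(X, ℝ) := CompactlySupportedContinuousMap.continuousMapEquiv
      ⟨fun x => (φ x).re, by fun_prop⟩
    let v : C_c(X, ℝ) := CompactlySupportedContinuousMap.continuousMapEquiv
      ⟨fun x => (φ x).im, by fun_prop⟩
    have e : φ = ι u + Complex.I • ι v := by
      ext x
      change φ x = ((φ x).re : ℂ) + Complex.I * ((φ x).im : ℂ)
      rw [mul_comm, Complex.re_add_im]
    rw [← integral_re_add_im (φ.integrable_of_compactSpace _)]
    conv_lhs => rw [e, ← ofUnitsₗ_apply, map_add, map_add, map_smul, map_smul, ofUnitsₗ_apply,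
      ofUnitsₗ_apply, hint, hint, smul_eq_mul, mul_comm]
    rfl
  refine ⟨⟨RealRMK.rieszMeasure Λ, hfin⟩, ⟨?_, hreg, fun V hV hVb => ?_⟩, hall⟩
  · have h := hall 1
    rw [ofUnits_one, hτ.1] at h
    simp only [ContinuousMap.one_apply, integral_const, Complex.real_smul, mul_one] at h
    have h' : (RealRMK.rieszMeasure Λ).real univ = 1 := by exact_mod_cast h.symm
    exact ⟨(ENNReal.toReal_eq_one_iff _).1 h'⟩
  · refine 𝒢.measure_src_eq_measure_rng h𝒢.1 (RealRMK.rieszMeasure Λ) (fun f => ?_) hV hVb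
    exact ((hall _).symm.trans (map_rngSum_eq h𝒢 hτ f)).trans (hall _)

variable [LocallyCompactSpace G]

/-- The invariant measure of a tracial state. -/
def measureOfTrace (h𝒢 : 𝒢.IsAlmostFinite) (τ : tracialStates 𝒢.reducedAlgebra) :
    𝒢.invariantMeasures :=
  ⟨(exists_measure_of_trace h𝒢 τ.2).choose, (exists_measure_of_trace h𝒢 τ.2).choose_spec.1⟩

lemma integral_measureOfTrace (h𝒢 : 𝒢.IsAlmostFinite) (τ : tracialStates 𝒢.reducedAlgebra)
    (φ : C(X, ℂ)) : ∫ x, φ x ∂((measureOfTrace h𝒢 τ : FiniteMeasure X) : Measure X) =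
      (τ : WeakDual ℂ 𝒢.reducedAlgebra) (𝒢.ofUnits φ) :=
  ((exists_measure_of_trace h𝒢 τ.2).choose_spec.2 φ).symm

lemma measureOfTrace_eq_iff (h𝒢 : 𝒢.IsAlmostFinite) (τ : tracialStates 𝒢.reducedAlgebra)
    (μ : 𝒢.invariantMeasures) : measureOfTrace h𝒢 τ = μ ↔ ∀ φ : C(X, ℂ),
      (τ : WeakDual ℂ 𝒢.reducedAlgebra) (𝒢.ofUnits φ) =
        ∫ x, φ x ∂((μ : FiniteMeasure X) : Measure X) := by
  constructor
  · rintro rfl φ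
    exact (integral_measureOfTrace h𝒢 τ φ).symm
  · intro h
    refine Subtype.ext (eq_of_integral_eq (measureOfTrace h𝒢 τ).2 μ.2 fun φ => ?_)
    rw [← h φ]
    exact integral_measureOfTrace h𝒢 τ φ

/-- Weak convergence is tested on real continuous functions, whose integrals are real parts of
evaluations of the trace. -/
lemma continuous_measureOfTrace (h𝒢 : 𝒢.IsAlmostFinite) : Continuous (measureOfTrace h𝒢) := by
  refine continuous_induced_rng.2 (continuous_iff_continuousAt.2 fun τ =>
    FiniteMeasure.tendsto_iff_forall_integral_tendsto.2 fun f => ?_)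
  let φ : C(X, ℂ) := ⟨fun x => (f x : ℂ), by fun_prop⟩
  have e : ∀ σ : tracialStates 𝒢.reducedAlgebra,
      ∫ x, f x ∂((measureOfTrace h𝒢 σ : FiniteMeasure X) : Measure X) =
        ((σ : WeakDual ℂ 𝒢.reducedAlgebra) (𝒢.ofUnits φ)).re := by
    intro σ
    rw [← integral_measureOfTrace h𝒢 σ φ]
    change _ = (∫ x, (f x : ℂ) ∂((measureOfTrace h𝒢 σ : FiniteMeasure X) : Measure X)).re
    rw [integral_complex_ofReal, Complex.ofReal_re]
  simp only [Function.comp_def, e]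
  exact (Complex.continuous_re.comp
    ((WeakDual.eval_continuous _).comp continuous_subtype_val)).continuousAt

/-- The canonical homeomorphism from the tracial states onto the invariant measures. -/
def traceHomeomorph (h𝒢 : 𝒢.IsAlmostFinite) :
    tracialStates 𝒢.reducedAlgebra ≃ₜ 𝒢.invariantMeasures where
  toFun := measureOfTrace h𝒢
  invFun μ := ⟨𝒢.traceOfMeasure μ, traceOfMeasure_mem h𝒢.1 μ.2⟩
  left_inv τ := by
    -- Recovering τ from its measure is precisely the factorisation τ = τ ∘ E.
    refine Subtype.ext (ContinuousLinearMap.ext fun a => ?_)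
    refine (traceOfMeasure_apply _ a).trans ?_
    rw [integral_measureOfTrace]
    exact (map_eq_map_expectation h𝒢 τ.2 a).symm
  right_inv μ := (measureOfTrace_eq_iff h𝒢 _ _).2 fun φ => by
    rw [traceOfMeasure_apply, expectation_ofUnits]
  continuous_toFun := continuous_measureOfTrace h𝒢
  continuous_invFun := continuous_induced_rng.2 (WeakDual.continuous_of_continuous_eval fun a =>
    (continuous_integral_complex (𝒢.expectation a)).comp continuous_subtype_val)

lemma traceHomeomorph_apply (h𝒢 : 𝒢.IsAlmostFinite) (τ : tracialStates 𝒢.reducedAlgebra) :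
    traceHomeomorph h𝒢 τ = measureOfTrace h𝒢 τ := rfl

lemma traceHomeomorph_add_smul (h𝒢 : 𝒢.IsAlmostFinite) (τ σ : tracialStates 𝒢.reducedAlgebra)
    {s t : NNReal} (hst : s + t = 1)
    (h : (s : ℝ) • (τ : WeakDual ℂ 𝒢.reducedAlgebra) +
      (t : ℝ) • (σ : WeakDual ℂ 𝒢.reducedAlgebra) ∈ tracialStates 𝒢.reducedAlgebra) :
    (traceHomeomorph h𝒢 ⟨_, h⟩ : FiniteMeasure X) =
      s • (traceHomeomorph h𝒢 τ : FiniteMeasure X) +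
        t • (traceHomeomorph h𝒢 σ : FiniteMeasure X) := by
  simp only [traceHomeomorph_apply]
  refine congrArg Subtype.val ((measureOfTrace_eq_iff h𝒢 ⟨_, h⟩ ⟨_, add_smul_mem_invariantMeasures
    (measureOfTrace h𝒢 τ).2 (measureOfTrace h𝒢 σ).2 hst⟩).2 fun φ => ?_)
  rw [integral_add_smul, integral_measureOfTrace, integral_measureOfTrace]
  exact add_smul_apply _ _ s t _

end EtaleGroupoid

/-! ### Orbit averages, existence of traces and Krein–Milman -/

namespace EtaleGroupoid

variable {X G : Type*} [TopologicalSpace X] [TopologicalSpace G] {𝒢 : EtaleGroupoid X G}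

section OrbitAverage

variable [CompactSpace X]

/-- The average over the orbit of `x` under a compact set `K` of arrows, as a functional on
`C(G⁽⁰⁾)`. -/
def orbitAverage (𝒢 : EtaleGroupoid X G) {K : Set G} (hK : IsCompact K) (x : X) :
    C(X, ℂ) →L[ℂ] ℂ :=
  LinearMap.mkContinuous
    { toFun := fun φ => ((𝒢.fiber K x).ncard : ℂ)⁻¹ *
        ∑ k ∈ (𝒢.finite_fiber hK x).toFinset, φ (𝒢.rng k)
      map_add' := fun φ ψ => by
        simp only [ContinuousMap.add_apply, Finset.sum_add_distrib, mul_add]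
      map_smul' := fun c φ => by
        simp only [ContinuousMap.smul_apply, smul_eq_mul, ← Finset.mul_sum, RingHom.id_apply]
        ring } 1 fun φ => by
    have h : ‖∑ k ∈ (𝒢.finite_fiber hK x).toFinset, φ (𝒢.rng k)‖ ≤ (𝒢.fiber K x).ncard * ‖φ‖ := by
      refine (norm_sum_le_of_le _ fun k _ => φ.norm_coe_le_norm (𝒢.rng k)).trans_eq ?_
      rw [Finset.sum_const, nsmul_eq_mul, ncard_eq_toFinset_card _ (𝒢.finite_fiber hK x)]
    simp only [LinearMap.coe_mk, AddHom.coe_mk, norm_mul, norm_inv, Complex.norm_natCast]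
    -- For a general compact K the fibre may be empty. The inverse is then 0, and n⁻¹n ≤ 1 still
    -- holds.
    refine (mul_le_mul_of_nonneg_left h (by positivity)).trans ?_
    rw [← mul_assoc]
    exact mul_le_mul_of_nonneg_right (inv_mul_le_one) (norm_nonneg _)

lemma orbitAverage_apply {K : Set G} (hK : IsCompact K) (x : X) (φ : C(X, ℂ)) :
    𝒢.orbitAverage hK x φ = ((𝒢.fiber K x).ncard : ℂ)⁻¹ *
      ∑ k ∈ (𝒢.finite_fiber hK x).toFinset, φ (𝒢.rng k) := rfl

lemma norm_orbitAverage_le {K : Set G} (hK : IsCompact K) (x : X) : ‖𝒢.orbitAverage hK x‖ ≤ 1 :=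
  LinearMap.mkContinuous_norm_le _ zero_le_one _

lemma orbitAverage_one {K : Set G} (hK : 𝒢.IsElementary K) (x : X) :
    𝒢.orbitAverage hK.isCompact x 1 = 1 := by
  rw [orbitAverage_apply]
  simp only [ContinuousMap.one_apply, Finset.sum_const, nsmul_eq_mul, mul_one]
  rw [← ncard_eq_toFinset_card _ (𝒢.finite_fiber hK.isCompact x)]
  exact inv_mul_cancel₀ (by exact_mod_cast (hK.fiber_ncard_pos x).ne')

lemma orbitAverage_nonneg {K : Set G} (hK : IsCompact K) (x : X) {φ : C(X, ℂ)}
    (hφ : ∀ x, 0 ≤ φ x) : 0 ≤ 𝒢.orbitAverage hK x φ := by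
  rw [orbitAverage_apply]
  refine mul_nonneg ?_ (Finset.sum_nonneg fun k _ => hφ _)
  rw [← Complex.ofReal_natCast, ← Complex.ofReal_inv]
  exact Complex.zero_le_real.2 (by positivity)

end OrbitAverage

variable [T2Space G]

/-- Along an almost invariant elementary subgroupoid, the orbit sums of the two fibre sums of a
function are close. -/
lemma norm_sum_rngSum_sub_le {C K : Set G} (hC : IsCompact C) (hCinv : ∀ a ∈ C, 𝒢.inv a ∈ C)
    (hK : 𝒢.IsElementary K) {ε : ℝ} (h : 𝒢.IsInvariantFor C ε K) {N : ℕ}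
    (hN : ∀ x, {a ∈ C | 𝒢.rng a = x}.encard ≤ N) {f : C_c(G, ℂ)} (hf : ∀ a ∉ C, f a = 0) {B : ℝ}
    (hB0 : 0 ≤ B) (hB : ∀ a, ‖f a‖ ≤ B) (x : X) :
    ‖∑ k ∈ (𝒢.finite_fiber hK.isCompact x).toFinset, 𝒢.rngSum f (𝒢.rng k) -
      ∑ k ∈ (𝒢.finite_fiber hK.isCompact x).toFinset, 𝒢.rngSum (𝒢.flip f) (𝒢.rng k)‖ ≤
      2 * (B * (N * ε * (𝒢.fiber K x).ncard)) := by
  have hKc : IsClopen K := ⟨hK.isCompact.isClosed, hK.isOpen⟩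
  -- The part of f on K has equal orbit sums for both fibre sums, so only its part g on C \ K
  -- contributes, once through each fibre sum; hence the factor 2.
  set g := hKc.compl.charFn • f with hg
  have hCK : IsCompact (C \ K) := hC.diff hK.isOpen
  have hg0 : ∀ a ∉ C \ K, g a = 0 := by
    intro a ha
    by_cases haC : a ∈ C
    · have haK : a ∈ K := by
        by_contra h'
        exact ha ⟨haC, h'⟩
      simp [hg, hKc.compl.charFn_notMem (not_not.2 haK)]
    · simp [hg, hf a haC]
  have hgB : ∀ a, ‖g a‖ ≤ B := by
    intro a
    by_cases ha : a ∈ K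
    · simpa [hg, hKc.compl.charFn_notMem (not_not.2 ha)] using hB0
    · simpa [hg, hKc.compl.charFn_mem ha] using hB a
  have hbound : ∀ u : C_c(G, ℂ), (∀ a ∉ C \ K, u a = 0) → (∀ a, ‖u a‖ ≤ B) →
      ‖∑ k ∈ (𝒢.finite_fiber hK.isCompact x).toFinset, 𝒢.rngSum (𝒢.flip u) (𝒢.rng k)‖ ≤
        B * (N * ε * (𝒢.fiber K x).ncard) := by
    intro u hu huB
    refine (norm_sum_le_of_le _ fun k _ => 𝒢.norm_rngSum_flip_le hCK hu huB (𝒢.rng k)).trans ?_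
    rw [← Finset.mul_sum, ← Nat.cast_sum, ← 𝒢.ncard_composablePairs_eq_sum hCK hK.isCompact x]
    exact mul_le_mul_of_nonneg_left (𝒢.ncard_composablePairs_le hC hK h hN x) hB0
  -- Since C and K are closed under inversion, the flip of g is also supported in C \ K, and the
  -- source-sum bound applied to it controls the range sums of g.
  have hflip0 : ∀ a ∉ C \ K, 𝒢.flip g a = 0 := by
    refine fun a ha => hg0 _ fun h' => ha ⟨?_, fun h'' => h'.2 (hK.inv_mem a h'')⟩
    rw [← 𝒢.inv_inv a]
    exact hCinv _ h'.1
  have h1 := hbound g hg0 hgB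
  have h2 := hbound (𝒢.flip g) hflip0 fun a => hgB _
  rw [flip_flip] at h2
  have h3 := hK.sum_rngSum_flip (f := hKc.charFn • f)
    (fun a ha => by simp [hKc.charFn_notMem ha]) x
  rw [← smul_charFn_add_compl hKc f]
  simp only [map_add, ContinuousMap.add_apply, Finset.sum_add_distrib]
  rw [h3, add_sub_add_left_eq_sub, two_mul]
  exact (norm_sub_le _ _).trans (add_le_add h2 h1)

variable [CompactSpace X]

lemma norm_orbitAverage_rngSum_sub_le {C K : Set G} (hC : IsCompact C)
    (hCinv : ∀ a ∈ C, 𝒢.inv a ∈ C) (hK : 𝒢.IsElementary K) {ε : ℝ} (h : 𝒢.IsInvariantFor C ε K)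
    {N : ℕ} (hN : ∀ x, {a ∈ C | 𝒢.rng a = x}.encard ≤ N) {f : C_c(G, ℂ)}
    (hf : ∀ a ∉ C, f a = 0) {B : ℝ} (hB0 : 0 ≤ B) (hB : ∀ a, ‖f a‖ ≤ B) (x : X) :
    ‖𝒢.orbitAverage hK.isCompact x (𝒢.rngSum f) -
      𝒢.orbitAverage hK.isCompact x (𝒢.rngSum (𝒢.flip f))‖ ≤ 2 * (B * (N * ε)) := by
  have hpos : (0 : ℝ) < (𝒢.fiber K x).ncard := by exact_mod_cast hK.fiber_ncard_pos x
  rw [orbitAverage_apply, orbitAverage_apply, ← mul_sub, norm_mul, norm_inv, Complex.norm_natCast,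
    inv_mul_le_iff₀ hpos]
  refine (norm_sum_rngSum_sub_le hC hCinv hK h hN hf hB0 hB x).trans_eq ?_
  ring

/-- An almost finite groupoid has an invariant state on `C(G⁽⁰⁾)`. -/
lemma exists_invariant_state [Nonempty X] (happ : 𝒢.HasElementaryApproximation) :
    ∃ L : C(X, ℂ) →L[ℂ] ℂ, L 1 = 1 ∧ (∀ φ : C(X, ℂ), (∀ x, 0 ≤ φ x) → 0 ≤ L φ) ∧
      ∀ f, L (𝒢.rngSum f) = L (𝒢.rngSum (𝒢.flip f)) := by
  obtain ⟨x⟩ := ‹Nonempty X›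
  -- The index set of pairs (compact set, n) is directed, so no exhaustion of G by countably many
  -- compact sets is required.
  choose K hK hKi using fun i : TopologicalSpace.Compacts G × ℕ =>
    happ i.1 i.1.isCompact (1 / ((i.2 : ℝ) + 1)) (by positivity)
  let L : TopologicalSpace.Compacts G × ℕ → WeakDual ℂ C(X, ℂ) :=
    fun i => StrongDual.toWeakDual (𝒢.orbitAverage (hK i).isCompact x)
  let 𝓕 : Ultrafilter (TopologicalSpace.Compacts G × ℕ) := Ultrafilter.of atTop
  have h𝓕 : (𝓕 : Filter (TopologicalSpace.Compacts G × ℕ)) ≤ atTop := Ultrafilter.of_le atTop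
  -- Orbit averages lie in the unit ball of the dual, so Banach–Alaoglu gives a limit along the
  -- ultrafilter.
  obtain ⟨L₀, -, hL₀⟩ := (WeakDual.isCompact_closedBall (𝕜 := ℂ)
    (0 : StrongDual ℂ C(X, ℂ)) 1).ultrafilter_le_nhds (𝓕.map L) (by
      refine le_principal_iff.2 (Ultrafilter.mem_map.2 (univ_mem' fun i => ?_))
      refine mem_closedBall_zero_iff.2 ?_
      exact norm_orbitAverage_le (hK i).isCompact x)
  have hlim : ∀ φ, Tendsto (fun i => L i φ) 𝓕 (𝓝 (L₀ φ)) := fun φ =>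
    ((WeakDual.eval_continuous φ).tendsto L₀).comp hL₀
  refine ⟨WeakDual.toStrongDual L₀, ?_, fun φ hφ => ?_, fun f => ?_⟩
  · exact tendsto_nhds_unique (hlim 1)
      (tendsto_const_nhds.congr fun i => (orbitAverage_one (hK i) x).symm)
  · exact ge_of_tendsto (hlim φ) (Eventually.of_forall fun i => orbitAverage_nonneg (hK i).isCompact x hφ)
  · obtain ⟨B, hB⟩ := f.hasCompactSupport.exists_bound_of_continuous f.continuous
    have hB0 : 0 ≤ B := (norm_nonneg _).trans (hB (𝒢.unit x))
    set C : Set G := tsupport f ∪ 𝒢.inv '' tsupport f with hCdef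
    have hC : IsCompact C := f.hasCompactSupport.isCompact.union
      (f.hasCompactSupport.isCompact.image 𝒢.continuous_inv)
    have hCinv : ∀ a ∈ C, 𝒢.inv a ∈ C := by
      rintro a (ha | ⟨b, hb, rfl⟩)
      · exact Or.inr ⟨a, ha, rfl⟩
      · rw [𝒢.inv_inv]
        exact Or.inl hb
    obtain ⟨N, hN⟩ := 𝒢.exists_rng_fiber_bound hC
    have hf : ∀ a ∉ C, f a = 0 := fun a ha =>
      image_eq_zero_of_notMem_tsupport fun h => ha (Or.inl h)
    have hdiff : Tendsto (fun i => L i (𝒢.rngSum f) - L i (𝒢.rngSum (𝒢.flip f))) 𝓕 (𝓝 0) := by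
      have hε : Tendsto (fun i : TopologicalSpace.Compacts G × ℕ =>
          2 * (B * (N * (1 / ((i.2 : ℝ) + 1))))) 𝓕 (𝓝 0) := by
        have h1 : Tendsto (fun i : TopologicalSpace.Compacts G × ℕ => i.2) atTop atTop := by
          rw [← prod_atTop_atTop_eq]
          exact tendsto_snd
        have h2 := ((tendsto_one_div_add_atTop_nhds_zero_nat (𝕜 := ℝ)).comp (h1.mono_left h𝓕))
        simpa using ((h2.const_mul (N : ℝ)).const_mul B).const_mul 2
      refine squeeze_zero_norm' ?_ hε
      -- Eventually the compact set of the index contains C, and invariance passes down to C.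
      filter_upwards [h𝓕 (eventually_ge_atTop (⟨C, hC⟩, 0))] with i hi
      exact norm_orbitAverage_rngSum_sub_le hC hCinv (hK i)
        ((hKi i).mono i.1.isCompact (hK i).isCompact hi.1) hN hf hB0 hB x
    exact sub_eq_zero.1 (tendsto_nhds_unique ((hlim _).sub (hlim _)) hdiff)

lemma tracialStates_nonempty [Nonempty X] (happ : 𝒢.HasElementaryApproximation) :
    (tracialStates 𝒢.reducedAlgebra).Nonempty := by
  obtain ⟨L, h1, h2, h3⟩ := exists_invariant_state happ
  exact ⟨_, 𝒢.comp_expectation_mem_tracialStates L h1 h2 h3⟩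

lemma isClosed_tracialStates {A : Type*} [NormedRing A] [StarRing A] [NormedAlgebra ℂ A] :
    IsClosed (tracialStates A) := by
  have e : tracialStates A = {τ | τ 1 = 1} ∩ ((⋂ a, {τ | 0 ≤ τ (star a * a)}) ∩
      ⋂ a, ⋂ b, {τ | τ (a * b) = τ (b * a)}) := by
    ext τ
    simp [tracialStates]
  rw [e]
  refine (isClosed_eq (WeakDual.eval_continuous _) continuous_const).inter
    ((isClosed_iInter fun a => isClosed_le continuous_const (WeakDual.eval_continuous _)).inter
      (isClosed_iInter fun a => isClosed_iInter fun b =>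
        isClosed_eq (WeakDual.eval_continuous _) (WeakDual.eval_continuous _)))

variable [LocallyCompactSpace G] [MeasurableSpace X] [BorelSpace X]

/-- By Banach–Alaoglu it is enough that τ has norm at most 1. This holds because τ integrates E(a)
against a probability measure and E is contractive. -/
lemma isCompact_tracialStates (h𝒢 : 𝒢.IsAlmostFinite) :
    IsCompact (tracialStates 𝒢.reducedAlgebra) := by
  refine (WeakDual.isCompact_closedBall (𝕜 := ℂ)
    (0 : StrongDual ℂ 𝒢.reducedAlgebra) 1).of_isClosed_subset isClosed_tracialStates
    fun τ hτ => mem_closedBall_zero_iff.2 ?_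
  refine ContinuousLinearMap.opNorm_le_bound _ zero_le_one fun a => ?_
  obtain ⟨μ, hμ, h⟩ := exists_measure_of_trace h𝒢 hτ
  have := hμ.1
  rw [one_mul]
  change ‖τ a‖ ≤ ‖a‖
  rw [map_eq_map_expectation h𝒢 hτ, h]
  refine (norm_integral_le_of_norm_le_const (C := ‖a‖) (Eventually.of_forall fun x =>
    ((𝒢.expectation a).norm_coe_le_norm x).trans (𝒢.norm_expectation_le a))).trans_eq ?_
  rw [probReal_univ, mul_one]

/-- Local convexity over the reals is what Krein–Milman asks of the ambient space of the traces. -/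
instance WeakDual.locallyConvexSpace {A : Type*} [NormedRing A] [NormedAlgebra ℂ A] :
    LocallyConvexSpace ℝ (WeakDual ℂ A) :=
  inferInstanceAs (LocallyConvexSpace ℝ (WeakBilin (topDualPairing ℂ A)))

lemma extremePoints_tracialStates_nonempty [Nonempty X] (h𝒢 : 𝒢.IsAlmostFinite) :
    (extremePoints ℝ (tracialStates 𝒢.reducedAlgebra)).Nonempty :=
  (isCompact_tracialStates h𝒢).extremePoints_nonempty (tracialStates_nonempty h𝒢.2)

end EtaleGroupoid

namespace EtaleGroupoid

variable {X G : Type*} [TopologicalSpace X] [TopologicalSpace G] {𝒢 : EtaleGroupoid X G}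
  [T2Space G] [CompactSpace X] [MeasurableSpace X] [BorelSpace X] [LocallyCompactSpace G]

lemma exists_traceHomeomorph_add_smul (h𝒢 : 𝒢.IsAlmostFinite)
    (τ σ : tracialStates 𝒢.reducedAlgebra) (s t : NNReal) (hst : s + t = 1) :
    ∃ h : (s : ℝ) • (τ : WeakDual ℂ 𝒢.reducedAlgebra) +
        (t : ℝ) • (σ : WeakDual ℂ 𝒢.reducedAlgebra) ∈ tracialStates 𝒢.reducedAlgebra,
      (traceHomeomorph h𝒢 ⟨_, h⟩ : FiniteMeasure X) =
        s • (traceHomeomorph h𝒢 τ : FiniteMeasure X) +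
          t • (traceHomeomorph h𝒢 σ : FiniteMeasure X) :=
  have h := add_smul_mem_tracialStates τ.2 σ.2 s.coe_nonneg t.coe_nonneg (by exact_mod_cast hst)
  ⟨h, traceHomeomorph_add_smul h𝒢 τ σ hst h⟩

end EtaleGroupoid

end

theorem mainTheorem5 {X G : Type*} [TopologicalSpace X] [TopologicalSpace G]
    [T2Space G] [LocallyCompactSpace G] [CompactSpace X] [Nonempty X]
    [MeasurableSpace X] [BorelSpace X]
    (𝒢 : EtaleGroupoid X G) (h𝒢 : 𝒢.IsAlmostFinite) :
    -- every tracial state factors through the canonical conditional expectation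
    (∀ τ ∈ tracialStates 𝒢.reducedAlgebra, ∀ a : 𝒢.reducedAlgebra,
      τ a = τ (𝒢.ofUnits (𝒢.expectation a))) ∧
    ∃ Φ : tracialStates 𝒢.reducedAlgebra ≃ₜ 𝒢.invariantMeasures,
      -- the homeomorphism is the canonical map, i.e. restriction to the continuous functions
      (∀ (τ : tracialStates 𝒢.reducedAlgebra) (μ : 𝒢.invariantMeasures),
        Φ τ = μ ↔ ∀ φ : C(X, ℂ),
          (τ : WeakDual ℂ 𝒢.reducedAlgebra) (𝒢.ofUnits φ) =
            ∫ x, φ x ∂((μ : MeasureTheory.FiniteMeasure X) : MeasureTheory.Measure X)) ∧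
      -- it is affine
      (∀ (τ σ : tracialStates 𝒢.reducedAlgebra) (s t : NNReal), s + t = 1 →
        ∃ h : (s : ℝ) • (τ : WeakDual ℂ 𝒢.reducedAlgebra) +
            (t : ℝ) • (σ : WeakDual ℂ 𝒢.reducedAlgebra) ∈ tracialStates 𝒢.reducedAlgebra,
          (Φ ⟨_, h⟩ : MeasureTheory.FiniteMeasure X) =
            s • (Φ τ : MeasureTheory.FiniteMeasure X) +
              t • (Φ σ : MeasureTheory.FiniteMeasure X)) ∧
      -- it identifies the extreme boundaries, which are non-empty
      (∀ τ : tracialStates 𝒢.reducedAlgebra,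
        (τ : WeakDual ℂ 𝒢.reducedAlgebra) ∈
            Set.extremePoints ℝ (tracialStates 𝒢.reducedAlgebra) ↔
          (Φ τ : MeasureTheory.FiniteMeasure X) ∈
            Set.extremePoints NNReal 𝒢.invariantMeasures) ∧
      (Set.extremePoints ℝ (tracialStates 𝒢.reducedAlgebra)).Nonempty ∧
      (Set.extremePoints NNReal 𝒢.invariantMeasures).Nonempty := by
  refine ⟨fun τ hτ a => EtaleGroupoid.map_eq_map_expectation h𝒢 hτ a,
    EtaleGroupoid.traceHomeomorph h𝒢, EtaleGroupoid.measureOfTrace_eq_iff h𝒢, ?_, ?_,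
    EtaleGroupoid.extremePoints_tracialStates_nonempty h𝒢, ?_⟩
  · exact EtaleGroupoid.exists_traceHomeomorph_add_smul h𝒢
  · exact mem_extremePoints_iff_of_affine (EtaleGroupoid.traceHomeomorph h𝒢).toEquiv
      (EtaleGroupoid.exists_traceHomeomorph_add_smul h𝒢)
  · obtain ⟨τ, hτ⟩ := EtaleGroupoid.extremePoints_tracialStates_nonempty h𝒢
    exact ⟨_, (mem_extremePoints_iff_of_affine (EtaleGroupoid.traceHomeomorph h𝒢).toEquiv
      (EtaleGroupoid.exists_traceHomeomorph_add_smul h𝒢) ⟨τ, hτ.1⟩).1 hτ⟩
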